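/- Let $R$ be a commutative ring. An alternating isomorphism on a finitely generated projective $R$-module $P$ is a non-degenerate alternating form on $P$, regarded as an isomorphism $P\to P^\vee$. Let $\psi_2$ be the form $\begin{pmatrix}0&1\\-1&0\end{pmatrix}$ on $R^2$ and $\psi_{2n}=\psi_2\perp\dots\perp\psi_2$ ($n$ summands). Let $V(R)$ be the quotient of the free abelian group on isometry classes $[P,g,f]$ of triples, with $P$ a finitely generated projective $R$-module and $g,f$ alternating isomorphisms on $P$, by the relations $[P\oplus P',g\perp g',f\perp f']=[P,g,f]+[P',g',f']$ and $[P,f_0,f_1]+[P,f_1,f_2]=[P,f_0,f_2]$. Let $V_{SL}(R)$ be the quotient of $V(R)$ by the further relations $[P,g,f]=[P,g,\varphi^\vee f\varphi]$ for $\varphi\in SL(P)$, where $SL(P)$ denotes the group of automorphisms of $P$ of determinant $1$. Let $\tilde V(R)\subset V(R)$ and $\tilde V_{SL}(R)\subset V_{SL}(R)$ be the subgroups of the classes $[R^{2n},\psi_{2n},M]$, where $n\ge 0$ and $M$ is an invertible alternating matrix of size $2n$ with Pfaffian $1$. The projection $V(R)\to V_{SL}(R)$ maps $\tilde V(R)$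 to $\tilde V_{SL}(R)$. Let $P_0$ be a finitely generated projective $R$-module of constant rank $2$ with an isomorphism $\theta_0:R\to\det(P_0)=\Lambda^2P_0$, and let $\chi_0(p,q)=\theta_0^{-1}(p\wedge q)$. Let $Um(P_0\oplus R)$ be the set of epimorphisms $a:P_0\oplus R\to R$, on which $SL(P_0\oplus R)$ acts on the right by $a\varphi=a\circ\varphi$. For $a\in Um(P_0\oplus R)$ and a section $s$ of $a$, put $P(a)=\ker(a)$, let $i_s:P_0\oplus R\to P(a)\oplus R$ be the isomorphism $p\mapsto(p-s(a(p)),a(p))$, let $\theta:R\to\det(P(a))$ be the composite of $\theta_0$ with the isomorphisms $\det(P_0)\cong\Lambda^3(P_0\oplus R)$, $p\wedge q\mapsto p\wedge q\wedge(0,1)$, and $\Lambda^3(P_0\oplus R)\cong\det(P(a))$, the inverse of $p\wedge q\mapsto p\wedge q\wedge s(1)$, and let $\chi_a(p,q)=\theta^{-1}(p\wedge q)$ on $P(a)$. The generalized Vaserstein symbol of $a$ is $$V(a)=[P_0\oplus R^2,\ \chi_0\perp\psi_2,\ (i_s\oplus 1)^t(\chi_a\perp\psi_2)(i_s\oplus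 1)].$$ **Theorem.** For every $a$ and $s$ this class lies in $\tilde V(R)$. For all $a\in Um(P_0\oplus R)$ and $\varphi\in SL(P_0\oplus R)$ one has $V(a)=V(a\varphi)$ in $\tilde V_{SL}(R)$, whatever sections of $a$ and $a\varphi$ are used to form the two symbols. Hence there is a unique map $V:Um(P_0\oplus R)/SL(P_0\oplus R)\to\tilde V_{SL}(R)$ that sends the orbit of every $a$ to the image of $V(a)$ in $\tilde V_{SL}(R)$, for every choice of section. -/

import Mathlib

universe u

namespace GenVaserstein

open Function Matrix

/-! ### Non-degenerate alternating forms -/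

/-- An alternating isomorphism `P → P^∨`, i.e. a non-degenerate alternating bilinear form on `P`:
`form p q` is the value of the form at `(p, q)`. -/
@[ext]
structure AltIso (R P : Type u) [CommRing R] [AddCommGroup P] [Module R P] where
  form : P →ₗ[R] Module.Dual R P
  alt : ∀ p, form p p = 0
  bij : Bijective form

namespace AltIso

variable {R P P' : Type u} [CommRing R] [AddCommGroup P] [Module R P]
  [AddCommGroup P'] [Module R P']

/-- The orthogonal sum `f ⊥ f'` on `P ⊕ P'`. -/
def perp (f : AltIso R P) (f' : AltIso R P') : AltIso R (P × P') where
  form := LinearMap.mk₂ R (fun x y => f.form x.1 y.1 + f'.form x.2 y.2)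
    (fun x x' y => by simp; abel) (fun c x y => by simp [mul_add])
    (fun x y y' => by simp; abel) (fun c x y => by simp [mul_add])
  alt x := by simp [f.alt, f'.alt]
  bij := by
    constructor
    · rw [← LinearMap.ker_eq_bot, LinearMap.ker_eq_bot']
      intro x hx
      ext
      · refine (map_eq_zero_iff f.form f.bij.1).1 (LinearMap.ext fun q => ?_)
        simpa using LinearMap.congr_fun hx (q, 0)
      · refine (map_eq_zero_iff f'.form f'.bij.1).1 (LinearMap.ext fun q => ?_)
        simpa using LinearMap.congr_fun hx (0, q)
    · intro l
      obtain ⟨x, hx⟩ := f.bij.2 (l ∘ₗ LinearMap.inl R P P')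
      obtain ⟨x', hx'⟩ := f'.bij.2 (l ∘ₗ LinearMap.inr R P P')
      refine ⟨(x, x'), LinearMap.ext fun y => ?_⟩
      simp [hx, hx', ← map_add]

/-- The pullback `h^∨ f' h` of a form along an isomorphism `h : P ≅ P'`. -/
def pullback (h : P ≃ₗ[R] P') (f' : AltIso R P') : AltIso R P where
  form := LinearMap.mk₂ R (fun x y => f'.form (h x) (h y))
    (fun x x' y => by simp) (fun c x y => by simp) (fun x y y' => by simp) (fun c x y => by simp)
  alt x := by simp [f'.alt]
  bij := by
    constructor
    · rw [← LinearMap.ker_eq_bot, LinearMap.ker_eq_bot']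
      intro x hx
      refine (map_eq_zero_iff h h.injective).1 ((map_eq_zero_iff f'.form f'.bij.1).1
        (LinearMap.ext fun q => ?_))
      simpa using LinearMap.congr_fun hx (h.symm q)
    · intro l
      obtain ⟨x, hx⟩ := f'.bij.2 (l ∘ₗ h.symm.toLinearMap)
      refine ⟨h.symm x, LinearMap.ext fun y => ?_⟩
      simp [hx]

@[simp] lemma perp_form (f : AltIso R P) (f' : AltIso R P') (x y : P × P') :
    (f.perp f').form x y = f.form x.1 y.1 + f'.form x.2 y.2 := rfl

@[simp] lemma pullback_form (h : P ≃ₗ[R] P') (f' : AltIso R P') (x y : P) :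
    (pullback h f').form x y = f'.form (h x) (h y) := rfl

/-- The form `ψ₂` on `R²`. -/
def psiTwo (R : Type u) [CommRing R] : AltIso R (R × R) where
  form := LinearMap.mk₂ R (fun x y => x.1 * y.2 - x.2 * y.1)
    (fun x x' y => by simp; ring) (fun c x y => by simp; ring)
    (fun x y y' => by simp; ring) (fun c x y => by simp; ring)
  alt x := by simp [mul_comm]
  bij := by
    constructor
    · rw [← LinearMap.ker_eq_bot, LinearMap.ker_eq_bot']
      intro x hx
      ext
      · simpa using LinearMap.congr_fun hx (0, 1)
      · simpa using LinearMap.congr_fun hx (1, 0)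
    · intro l
      refine ⟨(l (0, 1), - l (1, 0)), LinearMap.ext fun y => ?_⟩
      have : y = y.1 • ((1 : R), (0 : R)) + y.2 • ((0 : R), (1 : R)) := by ext <;> simp
      conv_rhs => rw [this]
      simp only [map_add, map_smul, LinearMap.mk₂_apply, smul_eq_mul]
      ring

end AltIso

/-! ### Alternating invertible matrices and the Pfaffian -/

/-- `M` is an alternating invertible matrix. -/
structure IsAltInvertible {R : Type u} [CommRing R] {m : ℕ}
    (M : Matrix (Fin m) (Fin m) R) : Prop where
  diag : ∀ i, M i i = 0
  skew : ∀ i j, M i j = - M j i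
  unit : IsUnit M.det

/-- The alternating isomorphism on `R^m` given by an alternating invertible matrix:
`(x, y) ↦ xᵗ M y`. -/
def AltIso.ofMatrix {R : Type u} [CommRing R] {m : ℕ} (M : Matrix (Fin m) (Fin m) R)
    (hM : IsAltInvertible M) : AltIso R (Fin m → R) where
  form := Matrix.toLinearMap₂' R M
  alt x := by
    rw [Matrix.toLinearMap₂'_apply, ← Finset.sum_product']
    refine Finset.sum_involution (fun p _ => p.swap) (fun p _ => ?_) (fun p _ hp => ?_)
      (fun _ _ => by simp) (fun _ _ => by simp)
    · simp only [Prod.fst_swap, Prod.snd_swap, hM.skew p.2 p.1, smul_eq_mul]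
      ring
    · rintro h
      have h' : p.1 = p.2 := (congrArg Prod.snd h)
      simp [h', hM.diag] at hp
  bij := by
    constructor
    · rw [← LinearMap.ker_eq_bot, LinearMap.ker_eq_bot']
      intro x hx
      have h0 : x ᵥ* M = 0 := by
        ext i
        have := LinearMap.congr_fun hx (Pi.single i 1)
        rw [Matrix.toLinearMap₂'_apply', Matrix.dotProduct_mulVec] at this
        simpa using this
      have h1 := congrArg (fun v => v ᵥ* M⁻¹) h0
      simpa [Matrix.vecMul_vecMul, Matrix.mul_nonsing_inv M hM.unit] using h1
    · intro l
      refine ⟨(fun i => l (Pi.single i 1)) ᵥ* M⁻¹, LinearMap.pi_ext' fun i =>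
        LinearMap.ext_ring ?_⟩
      simp only [LinearMap.comp_apply, LinearMap.single_apply]
      rw [Matrix.toLinearMap₂'_apply', Matrix.dotProduct_mulVec, Matrix.vecMul_vecMul,
        Matrix.nonsing_inv_mul M hM.unit, Matrix.vecMul_one]
      simp

/-- The matrices `ψ_{2n}`, with `ψ_{2n+2} = ψ_{2n} ⊥ ψ_2`. -/
def psi (R : Type u) [CommRing R] : (n : ℕ) → Matrix (Fin (2 * n)) (Fin (2 * n)) R
  | 0 => 0
  | n + 1 => Matrix.reindex finSumFinEquiv finSumFinEquiv
      (Matrix.fromBlocks (psi R n) 0 0 !![0, 1; -1, 0])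

lemma psi_isAltInvertible (R : Type u) [CommRing R] (n : ℕ) : IsAltInvertible (psi R n) := by
  induction n with
  | zero => exact ⟨fun i => i.elim0, fun i => i.elim0, by simp [psi, Matrix.det_isEmpty]⟩
  | succ n ih =>
    refine ⟨fun i => ?_, fun i j => ?_, ?_⟩
    · obtain ⟨i, rfl⟩ := (finSumFinEquiv (m := 2 * n) (n := 2)).surjective i
      rcases i with i | i
      · simpa [psi] using ih.diag i
      · fin_cases i <;> simp [psi]
    · obtain ⟨i, rfl⟩ := (finSumFinEquiv (m := 2 * n) (n := 2)).surjective i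
      obtain ⟨j, rfl⟩ := (finSumFinEquiv (m := 2 * n) (n := 2)).surjective j
      rcases i with i | i <;> rcases j with j | j
      · simpa [psi] using ih.skew i j
      · simp [psi]
      · simp [psi]
      · fin_cases i <;> fin_cases j <;> simp [psi]
    · have : (psi R (n + 1)).det = (psi R n).det := by
        simp only [psi]
        erw [Matrix.det_reindex_self, Matrix.det_fromBlocks_zero₂₁]
        simp [Matrix.det_fin_two]
      rw [this]; exact ih.unit

/-- The Pfaffian of an alternating matrix of size `2n`, by expansion along the first row:
`Pf M = ∑_{j ≥ 1} (-1)^(j-1) M_{0 j} Pf (M with rows and columns 0, j removed)`. -/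
def pfaffian {R : Type u} [CommRing R] : (n : ℕ) → Matrix (Fin (2 * n)) (Fin (2 * n)) R → R
  | 0, _ => 1
  | n + 1, M => ∑ j : Fin (2 * n + 1), (-1) ^ (j : ℕ) * M (0 : Fin (2 * n + 2)) j.succ *
      pfaffian n (M.submatrix (fun i => (j.succAbove i).succ) (fun i => (j.succAbove i).succ))

/-! ### The special linear group of a projective module -/

/-- `SL(P)`: the automorphisms of determinant `1` of a finitely generated projective module `P`.
The determinant is a function on `Spec R` that is computed on the free modules `P_𝔭`, so it is `1`
if and only if `det (φ_𝔭) = 1` for every prime `𝔭`. (`LinearMap.det` of Mathlib itself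
is only meaningful for free modules.) -/
def SL (R P : Type u) [CommRing R] [AddCommGroup P] [Module R P] : Subgroup (P ≃ₗ[R] P) where
  carrier := {φ | ∀ p : PrimeSpectrum R, LinearMap.det
    ((φ : P →ₗ[R] P).baseChange (Localization.AtPrime p.asIdeal)) = 1}
  one_mem' p := by
    simp
  mul_mem' {φ ψ} hφ hψ p := by
    have : ((φ * ψ : P ≃ₗ[R] P) : P →ₗ[R] P) = (φ : P →ₗ[R] P) ∘ₗ (ψ : P →ₗ[R] P) := rfl
    rw [this, LinearMap.baseChange_comp, LinearMap.det_comp, hφ p, hψ p, one_mul]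
  inv_mem' {φ} hφ p := by
    have h : ((φ⁻¹ : P ≃ₗ[R] P) : P →ₗ[R] P) ∘ₗ (φ : P →ₗ[R] P) = LinearMap.id := by
      ext x; exact φ.symm_apply_apply x
    have h2 := congrArg (fun f : P →ₗ[R] P =>
      LinearMap.det (f.baseChange (Localization.AtPrime p.asIdeal))) h
    simp only [LinearMap.baseChange_comp, LinearMap.det_comp, LinearMap.baseChange_id,
      LinearMap.det_id] at h2
    rwa [hφ p, mul_one] at h2

/-! ### The groups -/

/-- Triples `(P, g, f)`, with `P` a finitely generated projective module and `g = fst`, `f = snd`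
alternating isomorphisms on `P`. -/
structure Triple (R : Type u) [CommRing R] where
  carrier : Type u
  [addCommGroup : AddCommGroup carrier]
  [module : Module R carrier]
  [finite : Module.Finite R carrier]
  [projective : Module.Projective R carrier]
  fst : AltIso R carrier
  snd : AltIso R carrier

attribute [instance] Triple.addCommGroup Triple.module Triple.finite Triple.projective

/-- Isometry of triples: an isomorphism `h : P ≅ P'` with `g = h^∨ g' h` and `f = h^∨ f' h`. -/
def isometrySetoid (R : Type u) [CommRing R] : Setoid (Triple R) where
  r T T' := ∃ h : T.carrier ≃ₗ[R] T'.carrier,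
    T.fst = T'.fst.pullback h ∧ T.snd = T'.snd.pullback h
  iseqv :=
   { refl := fun T => ⟨LinearEquiv.refl R _, rfl, rfl⟩
     symm := by
      rintro T T' ⟨h, h1, h2⟩
      exact ⟨h.symm, by rw [h1]; ext x y; simp, by rw [h2]; ext x y; simp⟩
     trans := by
      rintro T T' T'' ⟨h, h1, h2⟩ ⟨k, k1, k2⟩
      exact ⟨h.trans k, by rw [h1, k1]; rfl, by rw [h2, k2]; rfl⟩ }

/-! ### Rank 2 modules and their determinants -/

lemma exists_local_pair {R P : Type u} [CommRing R] [AddCommGroup P] [Module R P]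
    [Module.Finite R P] [Module.Projective R P]
    (hr : ∀ p : PrimeSpectrum R, Module.rankAtStalk P p = 2) (m : Ideal R) [m.IsMaximal] :
    ∃ b₀ b₁ : P, ∀ x : P, ∃ s ∉ m, ∃ c₀ c₁ : R, s • x = c₀ • b₀ + c₁ • b₁ := by
  have hm : m.IsPrime := inferInstance
  let S := m.primeCompl
  have hfree : Module.Free (Localization.AtPrime m) (LocalizedModule m.primeCompl P) :=
    Module.free_of_flat_of_isLocalRing
  have h2 : Module.finrank (Localization.AtPrime m) (LocalizedModule m.primeCompl P) = 2 := hr ⟨m, hm⟩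
  let β := Module.finBasisOfFinrankEq _ _ h2
  have key : ∀ i, ∃ b : P, ∃ s : S, (β i) = LocalizedModule.mk b s := by
    intro i
    induction β i using LocalizedModule.induction_on with
    | h b s => exact ⟨b, s, rfl⟩
  choose b s hbs using key
  refine ⟨b 0, b 1, fun x => ?_⟩
  let f := LocalizedModule.mkLinearMap S P
  let N : Submodule R P := Submodule.span R {b 0, b 1}
  have htop : N.localized' (Localization.AtPrime m) S f = ⊤ := by
    rw [eq_top_iff, ← β.span_eq, Submodule.span_le]
    rintro _ ⟨i, rfl⟩
    refine ⟨b i, ?_, s i, ?_⟩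
    · fin_cases i
      · exact Submodule.subset_span (by simp)
      · exact Submodule.subset_span (by simp)
    · rw [hbs, ← IsLocalizedModule.mk_eq_mk']
  have hx : f x ∈ N.localized' (Localization.AtPrime m) S f := htop ▸ Submodule.mem_top
  obtain ⟨n, hn, t, ht⟩ := hx
  have h3 : f n = f (t.1 • x) := by
    rw [IsLocalizedModule.mk'_eq_iff] at ht
    rw [ht, map_smul]; rfl
  obtain ⟨u, hu⟩ := IsLocalizedModule.exists_of_eq (S := S) h3
  obtain ⟨c, d, hcd⟩ := Submodule.mem_span_pair.1 hn
  refine ⟨u.1 * t.1, (u * t).2, u.1 * c, u.1 * d, ?_⟩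
  have hu' : u.1 • n = u.1 • t.1 • x := hu
  rw [mul_smul, ← hu', ← hcd, smul_add, mul_smul, mul_smul]

lemma eq_zero_of_local {R N : Type u} [CommRing R] [AddCommGroup N] [Module R N] (v : N)
    (h : ∀ m : Ideal R, m.IsMaximal → ∃ s ∉ m, s • v = 0) : v = 0 := by
  by_contra hv
  have : Ideal.torsionOf R N v ≠ ⊤ := by
    rwa [Ne, Ideal.torsionOf_eq_top_iff]
  obtain ⟨m, hm, hle⟩ := Ideal.exists_le_maximal _ this
  obtain ⟨s, hs, h0⟩ := h m hm
  exact hs (hle h0)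

section
lemma neg_of_alt {R P N : Type u} [CommRing R] [AddCommGroup P] [Module R P] [AddCommGroup N]
    [Module R N] (B : P →ₗ[R] P →ₗ[R] N) (hB : ∀ x, B x x = 0) (x y : P) : B y x = - B x y := by
  have := hB (x + y)
  simp only [map_add, LinearMap.add_apply, hB, zero_add, add_zero] at this
  exact eq_neg_of_add_eq_zero_left this

variable {R P N : Type u} [CommRing R] [AddCommGroup P] [Module R P]
    [Module.Finite R P] [Module.Projective R P] [AddCommGroup N] [Module R N]

lemma plucker (hr : ∀ p : PrimeSpectrum R, Module.rankAtStalk P p = 2)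
    (χ : P →ₗ[R] P →ₗ[R] R) (hχ : ∀ x, χ x x = 0) (x y z : P) :
    χ x y • z + χ y z • x + χ z x • y = 0 := by
  refine eq_zero_of_local (R := R) _ fun m hm => ?_
  obtain ⟨b, c, H⟩ := exists_local_pair hr m
  obtain ⟨sx, hsx, x0, x1, hx⟩ := H x
  obtain ⟨sy, hsy, y0, y1, hy⟩ := H y
  obtain ⟨sz, hsz, z0, z1, hz⟩ := H z
  have hm' := hm.isPrime
  refine ⟨(sx * sy) * sz, fun h => ?_, ?_⟩
  · rcases hm'.mem_or_mem h with h | h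
    · rcases hm'.mem_or_mem h with h | h <;> contradiction
    · contradiction
  calc _ = χ (sx • x) (sy • y) • (sz • z) + χ (sy • y) (sz • z) • (sx • x)
      + χ (sz • z) (sx • x) • (sy • y) := by simp; module
    _ = 0 := by rw [hx, hy, hz]; simp [hχ, neg_of_alt χ hχ b c]; module

lemma alt3_eq_zero (hr : ∀ p : PrimeSpectrum R, Module.rankAtStalk P p = 2)
    (T : P [⋀^Fin 3]→ₗ[R] N) : T = 0 := by
  ext v
  refine eq_zero_of_local (R := R) _ fun m hm => ?_
  obtain ⟨b, c, H⟩ := exists_local_pair hr m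
  choose s hs c0 c1 hc using fun i => H (v i)
  have hm' := hm.isPrime
  refine ⟨∏ i, s i, fun h => ?_, ?_⟩
  · obtain ⟨i, -, hi⟩ := (Ideal.IsPrime.prod_mem_iff).1 h
    exact hs i hi
  rw [← T.map_smul_univ]
  simp_rw [hc]
  let w : Fin 2 → P := ![b, c]
  let co : Fin 3 → Fin 2 → R := fun i => ![c0 i, c1 i]
  have : (fun i => c0 i • b + c1 i • c) = fun i => ∑ j, co i j • w j := by
    ext i; simp [w, co]
  rw [this]
  change T.toMultilinearMap _ = 0
  rw [MultilinearMap.map_sum]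
  refine Finset.sum_eq_zero fun r _ => ?_
  rw [MultilinearMap.map_smul_univ]
  obtain ⟨i, j, hij, hne⟩ := Fintype.exists_ne_map_eq_of_card_lt r (by simp)
  have := T.map_eq_zero_of_eq (fun i => w (r i)) (i := i) (j := j) (by simp [hne]) hij
  erw [this, smul_zero]

lemma bijective_of_unimodular (hr : ∀ p : PrimeSpectrum R, Module.rankAtStalk P p = 2)
    (χ : P →ₗ[R] Module.Dual R P) (hχ : ∀ x, χ x x = 0)
    {ι : Type u} (t : Finset ι) (p q : ι → P) (h : ∑ i ∈ t, χ (p i) (q i) = 1) : Bijective χ := by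
  have hz : ∀ z, z = ∑ i ∈ t, (χ z (q i) • p i - χ z (p i) • q i) := by
    intro z
    calc z = (∑ i ∈ t, χ (p i) (q i)) • z := by rw [h, one_smul]
      _ = _ := by
        rw [Finset.sum_smul]
        refine Finset.sum_congr rfl fun i _ => ?_
        have := plucker hr χ hχ (p i) (q i) z
        rw [neg_of_alt χ hχ z (q i)] at this
        rw [neg_smul] at this
        rw [sub_eq_add_neg, ← sub_eq_zero, ← this]
        module
  constructor
  · rw [← LinearMap.ker_eq_bot, LinearMap.ker_eq_bot']
    intro z hz0
    rw [hz z, hz0]; simp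
  · intro l
    refine ⟨∑ i ∈ t, (l (q i) • p i - l (p i) • q i), LinearMap.ext fun z => ?_⟩
    conv_rhs => rw [hz z]
    simp only [map_sum, LinearMap.sum_apply, map_sub, map_smul, LinearMap.sub_apply, LinearMap.smul_apply, smul_eq_mul]
    refine Finset.sum_congr rfl fun i _ => ?_
    rw [neg_of_alt χ hχ z (p i), neg_of_alt χ hχ z (q i)]
    ring
end

section
variable {R M N : Type u} [CommRing R] [AddCommGroup M] [Module R M] [AddCommGroup N] [Module R N]

lemma update_one_pair {M : Type u} (p q x : M) : Function.update ![p, q] 1 x = ![p, x] := by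
  ext i; fin_cases i <;> rfl

/-- The bilinear map `(p, q) ↦ p ∧ q`. -/
noncomputable def wedge (R M : Type u) [CommRing R] [AddCommGroup M] [Module R M] :
    M →ₗ[R] M →ₗ[R] ⋀[R]^2 M :=
  LinearMap.mk₂ R (fun p q => exteriorPower.ιMulti R 2 ![p, q])
    (fun p p' q => by
      have := (exteriorPower.ιMulti R 2 (M := M)).map_vecCons_add ![q] p p'
      simpa using this)
    (fun c p q => by
      have := (exteriorPower.ιMulti R 2 (M := M)).map_vecCons_smul ![q] c p
      simpa using this)
    (fun p q q' => by
      have := (exteriorPower.ιMulti R 2 (M := M)).map_update_add ![p, q] 1 q q'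
      simpa only [update_one_pair] using this)
    (fun c p q => by
      have := (exteriorPower.ιMulti R 2 (M := M)).map_update_smul ![p, q] 1 c q
      simpa only [update_one_pair] using this)

lemma wedge_apply (p q : M) : wedge R M p q = exteriorPower.ιMulti R 2 ![p, q] := rfl

lemma wedge_self (p : M) : wedge R M p p = 0 :=
  (exteriorPower.ιMulti R 2).map_eq_zero_of_eq ![p, p] (i := 0) (j := 1) rfl (by simp)

/-- The map `⋀²M → ⋀³M`, `ξ ↦ t ∧ ξ = ξ ∧ t`. -/
noncomputable def wedgeVec (t : M) : ⋀[R]^2 M →ₗ[R] ⋀[R]^3 M :=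
  exteriorPower.alternatingMapLinearEquiv ((exteriorPower.ιMulti R 3).curryLeft t)

/-- The map `⋀²N → ⋀³M`, `p ∧ q ↦ j p ∧ j q ∧ t`, for a linear map `j : N → M` and `t ∈ M`. For a
split exact sequence `0 → N → M → R → 0` with `N` of rank 2 and `t` a lift of `1`, it is the induced
isomorphism `det N ≅ det M`. -/
noncomputable def detMap (j : N →ₗ[R] M) (t : M) : ⋀[R]^2 N →ₗ[R] ⋀[R]^3 M :=
  wedgeVec t ∘ₗ exteriorPower.map 2 j

lemma detMap_ιMulti (j : N →ₗ[R] M) (t : M) (v : Fin 2 → N) :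
    detMap j t (exteriorPower.ιMulti R 2 v) =
      exteriorPower.ιMulti R 3 ![t, j (v 0), j (v 1)] := by
  simp only [detMap, wedgeVec, LinearMap.comp_apply, exteriorPower.map_apply_ιMulti,
    exteriorPower.alternatingMapLinearEquiv_apply_ιMulti, AlternatingMap.curryLeft_apply_apply]
  congr 1
  ext i; fin_cases i <;> rfl

lemma detMap_coe (j : N →ₗ[R] M) (t : M) (ξ : ⋀[R]^2 N) :
    (detMap j t ξ : ExteriorAlgebra R M) =
      ExteriorAlgebra.ι R t * ExteriorAlgebra.map j (ξ : ExteriorAlgebra R N) := by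
  have : (⋀[R]^3 M).subtype ∘ₗ detMap j t = LinearMap.mulLeft R (ExteriorAlgebra.ι R t) ∘ₗ
      (ExteriorAlgebra.map j).toLinearMap ∘ₗ (⋀[R]^2 N).subtype := by
    apply exteriorPower.linearMap_ext
    ext v
    simp only [LinearMap.compAlternatingMap_apply, LinearMap.comp_apply, Submodule.subtype_apply,
      detMap_ιMulti, exteriorPower.ιMulti_apply_coe, LinearMap.mulLeft_apply,
      AlgHom.toLinearMap_apply, ExteriorAlgebra.map_apply_ιMulti]
    rw [ExteriorAlgebra.ιMulti_succ_apply]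
    congr 2
    ext i; fin_cases i <;> rfl
  exact LinearMap.congr_fun this ξ

lemma detMap_bijective [Module.Finite R N] [Module.Projective R N]
    (hr : ∀ p : PrimeSpectrum R, Module.rankAtStalk N p = 2)
    (j : N →ₗ[R] M) (a : M →ₗ[R] R) (t : M) (r : M →ₗ[R] N) (haj : ∀ x, a (j x) = 0)
    (hat : a t = 1) (hrj : ∀ x, r (j x) = x) (hv : ∀ v, v = a v • t + j (r v)) :
    Bijective (detMap j t) := by
  constructor
  · rw [← LinearMap.ker_eq_bot, LinearMap.ker_eq_bot']
    intro ξ hξ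
    have h0 : ExteriorAlgebra.ι R t * ExteriorAlgebra.map j (ξ : ExteriorAlgebra R N) = 0 := by
      rw [← detMap_coe, hξ]; rfl
    have hc : ∀ ξ : ⋀[R]^2 N, CliffordAlgebra.contractLeft (Q := (0 : QuadraticForm R M)) a
        (ExteriorAlgebra.map j (ξ : ExteriorAlgebra R N)) = 0 := by
      intro ξ
      have : CliffordAlgebra.contractLeft (Q := (0 : QuadraticForm R M)) a ∘ₗ
          (ExteriorAlgebra.map j).toLinearMap ∘ₗ (⋀[R]^2 N).subtype = 0 := by
        apply exteriorPower.linearMap_ext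
        ext v
        simp only [LinearMap.compAlternatingMap_apply, LinearMap.comp_apply,
          Submodule.subtype_apply, exteriorPower.ιMulti_apply_coe, AlgHom.toLinearMap_apply,
          ExteriorAlgebra.map_apply_ιMulti, LinearMap.zero_apply]
        rw [ExteriorAlgebra.ιMulti_succ_apply, ExteriorAlgebra.ιMulti_succ_apply,
          ExteriorAlgebra.ιMulti_zero_apply]
        erw [CliffordAlgebra.contractLeft_ι_mul, CliffordAlgebra.contractLeft_ι_mul]
        simp [haj, Matrix.vecTail]
      exact LinearMap.congr_fun this ξ
    have h1 := congrArg (CliffordAlgebra.contractLeft (Q := (0 : QuadraticForm R M)) a) h0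
    erw [CliffordAlgebra.contractLeft_ι_mul, hc ξ] at h1
    rw [hat, mul_zero, sub_zero, one_smul, map_zero] at h1
    have h2 := congrArg (ExteriorAlgebra.map r) h1
    have hid : r ∘ₗ j = LinearMap.id := LinearMap.ext hrj
    rw [← AlgHom.comp_apply, ExteriorAlgebra.map_comp_map, hid, ExteriorAlgebra.map_id] at h2
    exact Subtype.ext (by simpa using h2)
  · rw [← LinearMap.range_eq_top, eq_top_iff, ← exteriorPower.ιMulti_span, Submodule.span_le]
    rintro _ ⟨v, rfl⟩
    rw [SetLike.mem_coe, ← Submodule.Quotient.mk_eq_zero]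
    let T : M [⋀^Fin 3]→ₗ[R] (⋀[R]^3 M ⧸ LinearMap.range (detMap j t)) :=
      (LinearMap.range (detMap j t)).mkQ.compAlternatingMap (exteriorPower.ιMulti R 3)
    change T v = 0
    have hcyc : ∀ x y z, T ![x, y, z] = T ![y, z, x] := by
      intro x y z
      have := T.map_perm ![x, y, z] (finRotate 3)
      rw [sign_finRotate] at this
      have e : (![x, y, z] ∘ ⇑(finRotate 3)) = ![y, z, x] := by
        ext i; fin_cases i <;> simp
      rw [e] at this
      simpa using this.symm
    have hadd : ∀ (c : R) (x y z w : M), T ![c • x + w, y, z] = c • T ![x, y, z] + T ![w, y, z] := by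
      intro c x y z w
      have h1 := T.map_vecCons_add ![y, z] (c • x) w
      have h2 := T.map_vecCons_smul ![y, z] c x
      rw [h1, h2]
    have ht0 : ∀ x y, T ![t, j x, j y] = 0 := by
      intro x y
      have := detMap_ιMulti j t ![x, y]
      change Submodule.Quotient.mk _ = _
      rw [Submodule.Quotient.mk_eq_zero]
      exact ⟨_, this⟩
    have htt : ∀ x, T ![t, t, x] = 0 := fun x =>
      T.map_eq_zero_of_eq _ (i := 0) (j := 1) rfl (by simp)
    have htt' : ∀ x, T ![t, x, t] = 0 := fun x =>
      T.map_eq_zero_of_eq _ (i := 0) (j := 2) rfl (by simp)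
    have ht1 : ∀ x y, T ![t, j x, y] = 0 := by
      intro x y
      rw [hv y, hcyc, hcyc, hadd, htt, smul_zero, zero_add, hcyc, ht0]
    have ht2 : ∀ x y, T ![t, x, y] = 0 := by
      intro x y
      rw [hv x, hcyc, hadd, htt', smul_zero, zero_add, hcyc, hcyc, ht1]
    have hstep : ∀ x y z, T ![x, y, z] = T ![j (r x), y, z] := by
      intro x y z
      conv_lhs => rw [hv x, hadd, ht2, smul_zero, zero_add]
    have hve : v = ![v 0, v 1, v 2] := by ext i; fin_cases i <;> rfl
    rw [hve, hstep, hcyc, hstep, hcyc, hstep]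
    have := alt3_eq_zero hr (T.compLinearMap j)
    have h2 := congrArg (fun S => S ![r (v 2), r (v 0), r (v 1)]) this
    simp only [AlternatingMap.compLinearMap_apply, AlternatingMap.zero_apply] at h2
    rw [← h2]
    congr 1
    ext i; fin_cases i <;> rfl

lemma exists_sum_eq_one (θ : R ≃ₗ[R] ⋀[R]^2 M) :
    ∃ (t : Finset (Fin 2 → M)) (p q : (Fin 2 → M) → M),
      ∑ i ∈ t, θ.symm (wedge R M (p i) (q i)) = 1 := by
  have h : θ 1 ∈ Submodule.span R (Set.range (exteriorPower.ιMulti R 2 (M := M))) := by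
    rw [exteriorPower.ιMulti_span]; trivial
  obtain ⟨c, hc⟩ := Finsupp.mem_span_range_iff_exists_finsupp.1 h
  refine ⟨c.support, fun v => c v • v 0, fun v => v 1, ?_⟩
  have h1 := congrArg θ.symm hc
  rw [LinearEquiv.symm_apply_apply, Finsupp.sum, map_sum] at h1
  rw [← h1]
  refine Finset.sum_congr rfl fun v _ => ?_
  rw [map_smul, LinearMap.smul_apply, wedge_apply]
  congr 3
end

/-! ### The groups `V(R)`, `V_SL(R)` and their subgroups -/

section groups

variable (R : Type u) [CommRing R]

/-- Isometry classes of triples. -/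
def IsoClass : Type (u + 1) := Quotient (isometrySetoid R)

variable {R} in
/-- The generator `[P, g, f]` of the free abelian group on isometry classes of triples. -/
def gen {P : Type u} [AddCommGroup P] [Module R P] [Module.Finite R P] [Module.Projective R P]
    (g f : AltIso R P) : FreeAbelianGroup (IsoClass R) :=
  FreeAbelianGroup.of (Quotient.mk (isometrySetoid R) ⟨P, g, f⟩)

/-- The relations `[P ⊕ P', g ⊥ g', f ⊥ f'] = [P, g, f] + [P', g', f']`. -/
def sumRelations : Set (FreeAbelianGroup (IsoClass R)) :=
  {x | ∃ T T' : Triple R, x = gen (T.fst.perp T'.fst) (T.snd.perp T'.snd) -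
    (gen T.fst T.snd + gen T'.fst T'.snd)}

/-- The relations `[P, f₀, f₁] + [P, f₁, f₂] = [P, f₀, f₂]`. -/
def chainRelations : Set (FreeAbelianGroup (IsoClass R)) :=
  {x | ∃ (T : Triple R) (f₂ : AltIso R T.carrier),
    x = gen T.fst T.snd + gen T.snd f₂ - gen T.fst f₂}

/-- The relations `[P, g, f] = [P, g, φ^∨ f φ]` for `φ ∈ SL(P)`. -/
def slRelations : Set (FreeAbelianGroup (IsoClass R)) :=
  {x | ∃ (T : Triple R), ∃ φ ∈ SL R T.carrier,
    x = gen T.fst T.snd - gen T.fst (T.snd.pullback φ)}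

/-- The group `V(R)`. -/
abbrev V : Type (u + 1) :=
  FreeAbelianGroup (IsoClass R) ⧸ AddSubgroup.closure (sumRelations R ∪ chainRelations R)

/-- The group `V_SL(R)`. -/
abbrev VSL : Type (u + 1) :=
  FreeAbelianGroup (IsoClass R) ⧸
    AddSubgroup.closure (sumRelations R ∪ chainRelations R ∪ slRelations R)

variable {R} in
/-- The class of `[P, g, f]` in `V(R)`. -/
def V.cls {P : Type u} [AddCommGroup P] [Module R P] [Module.Finite R P] [Module.Projective R P]
    (g f : AltIso R P) : V R :=
  QuotientAddGroup.mk (gen g f)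

variable {R} in
/-- The class of `[P, g, f]` in `V_SL(R)`. -/
def VSL.cls {P : Type u} [AddCommGroup P] [Module R P] [Module.Finite R P] [Module.Projective R P]
    (g f : AltIso R P) : VSL R :=
  QuotientAddGroup.mk (gen g f)

/-- The canonical epimorphism `V(R) → V_SL(R)`. -/
def V.toVSL : V R →+ VSL R :=
  QuotientAddGroup.map _ _ (AddMonoidHom.id _)
    (AddSubgroup.closure_mono Set.subset_union_left)

/-- The subgroup `Ṽ(R)` of `V(R)` corresponding to `W_E(R)`, the kernel of the Pfaffian on
`W'_E(R)`, under the isomorphism `W'_E(R) ≅ V(R)` that maps the class of an alternating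
invertible matrix `M` of size `2n` to `[R^{2n}, ψ_{2n}, M]`: it consists of the images of the `M`
with `Pf M = 1`. -/
def Vtilde : AddSubgroup (V R) :=
  AddSubgroup.closure {x | ∃ (n : ℕ) (M : Matrix (Fin (2 * n)) (Fin (2 * n)) R)
    (hM : IsAltInvertible M), pfaffian n M = 1 ∧
      x = V.cls (AltIso.ofMatrix (psi R n) (psi_isAltInvertible R n)) (AltIso.ofMatrix M hM)}

/-- The subgroup `Ṽ_SL(R)` of `V_SL(R)` corresponding to `W_SL(R)`, the kernel of the Pfaffian on
`W'_SL(R)`, under the isomorphism `W'_SL(R) ≅ V_SL(R)` that maps the class of an alternating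
invertible matrix `M` of size `2n` to `[R^{2n}, ψ_{2n}, M]`: it consists of the images of the `M`
with `Pf M = 1`. -/
def VtildeSL : AddSubgroup (VSL R) :=
  AddSubgroup.closure {x | ∃ (n : ℕ) (M : Matrix (Fin (2 * n)) (Fin (2 * n)) R)
    (hM : IsAltInvertible M), pfaffian n M = 1 ∧
      x = VSL.cls (AltIso.ofMatrix (psi R n) (psi_isAltInvertible R n)) (AltIso.ofMatrix M hM)}

lemma Vtilde_le : Vtilde R ≤ (VtildeSL R).comap (V.toVSL R) := by
  rw [Vtilde, AddSubgroup.closure_le]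
  rintro _ ⟨n, M, hM, hpf, rfl⟩
  exact AddSubgroup.subset_closure ⟨n, M, hM, hpf, rfl⟩

/-- The canonical epimorphism `Ṽ(R) → Ṽ_SL(R)`. -/
def Vtilde.toSL : Vtilde R →+ VtildeSL R :=
  ((V.toVSL R).comp (Vtilde R).subtype).codRestrict (VtildeSL R) fun x => Vtilde_le R x.2

end groups

/-! ### Epimorphisms onto `R` and their orbits -/

section Um

variable {R M : Type u} [CommRing R] [AddCommGroup M] [Module R M]

/-- `Um(M)`: the epimorphisms `M → R`. -/
def Um (R M : Type u) [CommRing R] [AddCommGroup M] [Module R M] : Type u :=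
  {a : M →ₗ[R] R // Surjective a}

/-- The right action of `Aut(M)` on `Um(M)`: `a φ = a ∘ φ`. -/
def Um.act (a : Um R M) (φ : M ≃ₗ[R] M) : Um R M :=
  ⟨a.1 ∘ₗ φ.toLinearMap, a.2.comp φ.surjective⟩

/-- The orbit equivalence relation of `SL(M)` on `Um(M)`. -/
def Um.slSetoid (R M : Type u) [CommRing R] [AddCommGroup M] [Module R M] : Setoid (Um R M) where
  r a b := ∃ φ ∈ SL R M, a.act φ = b
  iseqv :=
   { refl := fun a => ⟨1, one_mem _, rfl⟩
     symm := by
      rintro a b ⟨φ, hφ, rfl⟩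
      exact ⟨φ⁻¹, inv_mem hφ, Subtype.ext (LinearMap.ext fun x =>
        congrArg a.1 (φ.apply_symm_apply x))⟩
     trans := by
      rintro a b c ⟨φ, hφ, rfl⟩ ⟨ψ, hψ, rfl⟩
      exact ⟨φ * ψ, mul_mem hφ hψ, rfl⟩ }

/-- The orbit space `Um(M)/SL(M)`. -/
def Um.OrbitSL (R M : Type u) [CommRing R] [AddCommGroup M] [Module R M] : Type u :=
  Quotient (Um.slSetoid R M)

/-- The orbit of `a`. -/
def Um.orbit (a : Um R M) : Um.OrbitSL R M := Quotient.mk (Um.slSetoid R M) a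

/-- Sections `s : R → M` of `a`. -/
def Um.Sec (a : Um R M) : Type u := {s : R →ₗ[R] M // a.1 ∘ₗ s = LinearMap.id}

variable {a : Um R M}

lemma Um.Sec.apply (s : a.Sec) (c : R) : a.1 (s.1 c) = c := LinearMap.congr_fun s.2 c

/-- The kernel `P(a)` of `a`. -/
abbrev Um.ker (a : Um R M) : Submodule R M := LinearMap.ker a.1

/-- The retraction `r_s : M → P(a)`, `p ↦ p - s (a p)`. -/
def Um.Sec.retraction (s : a.Sec) : M →ₗ[R] a.ker :=
  (LinearMap.id - s.1 ∘ₗ a.1).codRestrict a.ker fun v => by simp [s.apply]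

/-- The isomorphism `i_s : M → P(a) ⊕ R`, `p ↦ (r_s p, a p)`. -/
def Um.Sec.iso (s : a.Sec) : M ≃ₗ[R] a.ker × R :=
  LinearEquiv.ofLinearMap (s.retraction.prod a.1) (a.ker.subtype.coprod s.1)
    (by
      ext x
      · simp [Um.Sec.retraction]
      · simp
      · simp [Um.Sec.retraction, s.apply]
      · simp [s.apply])
    (by ext x; simp [Um.Sec.retraction])

lemma Um.Sec.retraction_subtype (s : a.Sec) (x : a.ker) : s.retraction x = x := by
  ext; simp [Um.Sec.retraction]

instance Um.finite_ker [Module.Finite R M] (a : Um R M) : Module.Finite R a.ker := by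
  obtain ⟨s, hs⟩ := Module.projective_lifting_property a.1 LinearMap.id a.2
  let s' : a.Sec := ⟨s, hs⟩
  exact Module.Finite.of_surjective s'.retraction fun x => ⟨x, s'.retraction_subtype x⟩

instance Um.projective_ker [Module.Projective R M] (a : Um R M) : Module.Projective R a.ker := by
  obtain ⟨s, hs⟩ := Module.projective_lifting_property a.1 LinearMap.id a.2
  let s' : a.Sec := ⟨s, hs⟩
  exact Module.Projective.of_split a.ker.subtype s'.retraction
    (LinearMap.ext fun x => s'.retraction_subtype x)

end Um

/-! ### The generalized Vaserstein symbol -/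

section symbol

variable {R P : Type u} [CommRing R] [AddCommGroup P] [Module R P] [Module.Finite R P]
  [Module.Projective R P]

/-- `P` has constant rank 2. -/
def HasRankTwo (R P : Type u) [CommRing R] [AddCommGroup P] [Module R P] : Prop :=
  ∀ p : PrimeSpectrum R, Module.rankAtStalk P p = 2

lemma HasRankTwo.ker (hP : HasRankTwo R P) (a : Um R (P × R)) : HasRankTwo R a.ker := by
  intro p
  have : Nontrivial R := PrimeSpectrum.nontrivial p
  obtain ⟨s, hs⟩ := Module.projective_lifting_property a.1 LinearMap.id a.2
  let s' : a.Sec := ⟨s, hs⟩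
  have h := congrFun (Module.rankAtStalk_eq_of_equiv s'.iso) p
  rw [Module.rankAtStalk_prod, Module.rankAtStalk_prod, Pi.add_apply, Pi.add_apply, hP p] at h
  omega

/-- The alternating form `(p, q) ↦ θ⁻¹ (p ∧ q)` given by a trivialization `θ : R ≅ det P` of the
determinant of a projective module of rank 2. -/
noncomputable def detForm (hP : HasRankTwo R P) (θ : R ≃ₗ[R] ⋀[R]^2 P) : AltIso R P where
  form := (wedge R P).compr₂ θ.symm.toLinearMap
  alt p := by simp [wedge_self]
  bij := by
    obtain ⟨t, p, q, h⟩ := exists_sum_eq_one θ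
    exact bijective_of_unimodular hP ((wedge R P).compr₂ θ.symm.toLinearMap)
      (fun p => by simp [wedge_self]) t p q h

/-- The canonical isomorphism `det P ≅ det (P ⊕ R)`, `p ∧ q ↦ p ∧ q ∧ (0, 1)`. -/
noncomputable def detStab (hP : HasRankTwo R P) : (⋀[R]^2 P) ≃ₗ[R] ⋀[R]^3 (P × R) :=
  LinearEquiv.ofBijective (detMap (LinearMap.inl R P R) (0, 1))
    (detMap_bijective hP _ (LinearMap.snd R P R) _ (LinearMap.fst R P R) (by simp) (by simp)
      (by simp) (fun v => by ext <;> simp))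

/-- The isomorphism `det (P(a)) ≅ det (P ⊕ R)`, `p ∧ q ↦ p ∧ q ∧ s(1)`, given by the exact sequence
`0 → P(a) → P ⊕ R → R → 0` with section `s`. -/
noncomputable def detKer (hP : HasRankTwo R P) (a : Um R (P × R)) (s : a.Sec) :
    (⋀[R]^2 a.ker) ≃ₗ[R] ⋀[R]^3 (P × R) :=
  LinearEquiv.ofBijective (detMap a.ker.subtype (s.1 1))
    (detMap_bijective (hP.ker a) _ a.1 _ s.retraction (fun x => x.2) (s.apply 1)
      s.retraction_subtype (fun v => by
        have : a.1 v • s.1 1 = s.1 (a.1 v) := by rw [← map_smul, smul_eq_mul, mul_one]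
        simp [this, Um.Sec.retraction]))

/-- The form `χ_a` on `P(a)`: it is given by the trivialization
`R ≅ det P ≅ det (P ⊕ R) ≅ det (P(a))` of the determinant of `P(a)`. -/
noncomputable def chi (hP : HasRankTwo R P) (θ₀ : R ≃ₗ[R] ⋀[R]^2 P) (a : Um R (P × R))
    (s : a.Sec) : AltIso R a.ker :=
  detForm (hP.ker a) ((θ₀.trans (detStab hP)).trans (detKer hP a s).symm)

/-- The isomorphism `i_s ⊕ 1 : P ⊕ R² → P(a) ⊕ R²`. -/
noncomputable def isoPlusOne (a : Um R (P × R)) (s : a.Sec) :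
    (P × (R × R)) ≃ₗ[R] a.ker × (R × R) :=
  ((LinearEquiv.prodAssoc R P R R).symm.trans
    (s.iso.prodCongr (LinearEquiv.refl R R))).trans (LinearEquiv.prodAssoc R a.ker R R)

/-- The form `V(a, s) = (i_s ⊕ 1)^t (χ_a ⊥ ψ₂) (i_s ⊕ 1)` on `P ⊕ R²`. -/
noncomputable def vForm (hP : HasRankTwo R P) (θ₀ : R ≃ₗ[R] ⋀[R]^2 P) (a : Um R (P × R))
    (s : a.Sec) : AltIso R (P × (R × R)) :=
  ((chi hP θ₀ a s).perp (AltIso.psiTwo R)).pullback (isoPlusOne a s)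

/-- The element `[P ⊕ R², χ₀ ⊥ ψ₂, V(a, s)]` of `V(R)`. -/
noncomputable def vaserstein (hP : HasRankTwo R P) (θ₀ : R ≃ₗ[R] ⋀[R]^2 P) (a : Um R (P × R))
    (s : a.Sec) : V R :=
  V.cls ((detForm hP θ₀).perp (AltIso.psiTwo R)) (vForm hP θ₀ a s)

end symbol

end GenVaserstein

open GenVaserstein

/-! Write `v = (p, x, y)` for a vector of `P₀ ⊕ R²` and `v̄ = (p, x)` for its part in `P₀ ⊕ R`. The
trivialization `θ₀` gives a volume form `vol` on `P₀ ⊕ R`, and by `vForm_form` the second form of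
the symbol is `vol(s(1), v̄, w̄)` plus the form `a ∧ y`. Everything rests on this formula.

Membership. Since `χ₀` takes values with sum 1, the Plücker relation in rank two writes it as a sum
of forms `χ₀(pᵢ, -) ∧ χ₀(qᵢ, -)`. Hence `P₀` embeds isometrically into some `ψ_{2k}`
(`exists_isometry_psiForm`) and splits off, with a complement `(N, h)`
(`exists_orthogonal_complement`). As `[N, h, h] = 0`, adding `h` to both forms does not change the
class, so the symbol is the class of a matrix `M` of size `2k + 2`. With `s(1) = (q, d)` and `a =
χ₀(α, -) + c x`, the second form is `d χ₀ + χ₀(q, -) ∧ x + χ₀(α, -) ∧ y + c x ∧ y`. By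
`pfFunctional_blockForm_eq` its sum with `h` has Pfaffian `(c d + χ₀(α, q)) r`, with `r` independent
of `α, q, c, d`. The first factor is `a(s(1)) = 1`. The form `χ₀ ⊥ ψ₂` is the case `α = q = 0`, `c =
d = 1`, so `r` is the Pfaffian of `ψ_{2k+2}`, which is 1.

`P₀` need not be free, so no Pfaffian of `χ₀` itself is available. Instead the Pfaffian is extended
to a functional on the whole exterior algebra (`pfFunctional`), where adding a form `μ ∧ ν` amounts
to a double contraction. Rank two enters through the Plücker relation and the vanishing of
alternating trilinear maps on `P₀`.

Invariance. If `s` becomes `s'`, put `k = s'(1) - s(1)`, which lies in `ker a`. The 4-form `a ∧ vol`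
vanishes in rank three, so `vol(k, -, -) = a ∧ f` with `f = vol(k, s(1), -)`, and this change is
absorbed by the transvection `y ↦ y + f` (`VSL.cls_vForm_section`). If `a` becomes `a φ`, the
section `φ⁻¹ s` makes the new form the pullback of the old one along `φ ⊕ 1`, because `vol` is
invariant under `SL` (`VSL.cls_vForm_act`). -/

namespace GenVaserstein

open Function Matrix

/-! ### The Pfaffian as a functional on the exterior algebra -/

section pf

variable {R W : Type u} [CommRing R] [AddCommGroup W] [Module R W]

local infixl:70 "⌋" => CliffordAlgebra.contractLeft (Q := (0 : QuadraticForm R _))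

lemma neg_toQuadraticMap_of_alt (B : W →ₗ[R] W →ₗ[R] R) (hB : ∀ x, B x x = 0) :
    LinearMap.BilinMap.toQuadraticMap (-B) =
      (0 : QuadraticForm R W) - (0 : QuadraticForm R W) := by
  ext x; simp [hB]

/-- The automorphism `exp B` of the module `⋀ W` given by contraction with an alternating form
`B`. -/
noncomputable def expContract (B : W →ₗ[R] W →ₗ[R] R) (hB : ∀ x, B x x = 0) :
    ExteriorAlgebra R W →ₗ[R] ExteriorAlgebra R W :=
  CliffordAlgebra.changeForm (neg_toQuadraticMap_of_alt B hB)

/-- The linear functional on `⋀ W` that maps `v₁ ∧ ⋯ ∧ v_{2n}` to the Pfaffian of the Gram matrix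
of an alternating form `B`. -/
noncomputable def pfFunctional (B : W →ₗ[R] W →ₗ[R] R) (hB : ∀ x, B x x = 0) :
    ExteriorAlgebra R W →ₗ[R] R :=
  ExteriorAlgebra.algebraMapInv.toLinearMap ∘ₗ expContract B hB

lemma pfFunctional_one (B : W →ₗ[R] W →ₗ[R] R) (hB : ∀ x, B x x = 0) :
    pfFunctional B hB 1 = 1 := by
  simp only [pfFunctional, expContract, LinearMap.comp_apply]
  erw [CliffordAlgebra.changeForm_one]
  simp

lemma expContract_ι_mul (B : W →ₗ[R] W →ₗ[R] R) (hB : ∀ x, B x x = 0) (v : W)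
    (x : ExteriorAlgebra R W) : expContract B hB (ExteriorAlgebra.ι R v * x) =
      ExteriorAlgebra.ι R v * expContract B hB x + B v⌋expContract B hB x := by
  have := CliffordAlgebra.changeForm_ι_mul (neg_toQuadraticMap_of_alt B hB) v x
  simp only [LinearMap.neg_apply, map_neg, sub_neg_eq_add] at this
  exact this

/-- The augmentation kills multiples of `v`, and contraction commutes with `exp B`. This is the
coordinate-free form of expansion along the first row. -/
lemma pfFunctional_ι_mul (B : W →ₗ[R] W →ₗ[R] R) (hB : ∀ x, B x x = 0) (v : W)
    (x : ExteriorAlgebra R W) :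
    pfFunctional B hB (ExteriorAlgebra.ι R v * x) = pfFunctional B hB (B v⌋x) := by
  have h := CliffordAlgebra.changeForm_contractLeft (neg_toQuadraticMap_of_alt B hB) (B v) x
  simp only [pfFunctional, LinearMap.comp_apply, expContract_ι_mul, map_add]
  simp only [expContract, h]
  simp [ExteriorAlgebra.algebraMapInv]

lemma contractLeft_ι_mul' (d : Module.Dual R W) (v : W) (x : ExteriorAlgebra R W) :
    d⌋(ExteriorAlgebra.ι R v * x) = d v • x - ExteriorAlgebra.ι R v * (d⌋x) :=
  CliffordAlgebra.contractLeft_ι_mul (Q := 0) d v x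

lemma contractLeft_ιMulti (d : Module.Dual R W) (n : ℕ) (v : Fin (n + 1) → W) :
    d⌋(ExteriorAlgebra.ιMulti R (n + 1) v) =
      ∑ j : Fin (n + 1), ((-1) ^ (j : ℕ) * d (v j)) • ExteriorAlgebra.ιMulti R n (fun i => v (j.succAbove i)) := by
  induction n with
  | zero =>
    rw [ExteriorAlgebra.ιMulti_succ_apply, contractLeft_ι_mul']
    simp only [ExteriorAlgebra.ιMulti_zero_apply]
    erw [CliffordAlgebra.contractLeft_one]
    simp
  | succ n ih =>
    rw [ExteriorAlgebra.ιMulti_succ_apply, contractLeft_ι_mul', ih, Finset.mul_sum,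
      Fin.sum_univ_succ (n := n + 1), sub_eq_add_neg, ← Finset.sum_neg_distrib]
    congr 1
    · simp [vecTail, Function.comp_def]
    · refine Finset.sum_congr rfl fun j _ => ?_
      rw [ExteriorAlgebra.ιMulti_succ_apply (fun i => v (j.succ.succAbove i))]
      simp [vecTail, Function.comp_def, pow_succ]

/-- Both sides obey the same recursion: contracting a product of vectors with `B v₀` produces
exactly the signed terms of the first-row expansion. -/
lemma pfaffian_gram (B : W →ₗ[R] W →ₗ[R] R) (hB : ∀ x, B x x = 0) (n : ℕ) (v : Fin (2 * n) → W) :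
    pfaffian n (Matrix.of fun i j => B (v i) (v j)) =
      pfFunctional B hB (ExteriorAlgebra.ιMulti R (2 * n) v) := by
  induction n with
  | zero =>
    rw [show ExteriorAlgebra.ιMulti R (2 * 0) v = 1 from ExteriorAlgebra.ιMulti_zero_apply v,
      pfFunctional_one]
    rfl
  | succ n ih =>
    have h := ExteriorAlgebra.ιMulti_succ_apply (R := R) (n := 2 * n + 1) v
    change _ = pfFunctional B hB (ExteriorAlgebra.ιMulti R (2 * n + 1 + 1) v)
    rw [h, pfFunctional_ι_mul, contractLeft_ιMulti, map_sum]
    simp only [pfaffian, map_smul, smul_eq_mul]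
    refine Finset.sum_congr rfl fun j _ => ?_
    rw [← ih]
    rfl

/-- The alternating form `μ ∧ ν`. -/
def wedgeForm (μ ν : Module.Dual R W) : W →ₗ[R] W →ₗ[R] R :=
  μ.smulRight ν - ν.smulRight μ

@[simp] lemma wedgeForm_apply (μ ν : Module.Dual R W) (v w : W) :
    wedgeForm μ ν v w = μ v * ν w - ν v * μ w := by simp [wedgeForm]

lemma wedgeForm_self (μ ν : Module.Dual R W) (v : W) : wedgeForm μ ν v v = 0 := by
  simp [mul_comm]

/-- The operator `D` is contraction with the 2-form `C`. The hypothesis `hCD` stops the exponential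
series after its linear term, so `exp C = 1 + D`; then `exp (B + C) = exp B ∘ exp C`. No division by
factorials occurs. -/
lemma pfFunctional_add (B C : W →ₗ[R] W →ₗ[R] R) (hB : ∀ x, B x x = 0) (hC : ∀ x, C x x = 0)
    (hBC : ∀ x, (B + C) x x = 0) (D : ExteriorAlgebra R W →ₗ[R] ExteriorAlgebra R W)
    (hD1 : D 1 = 0) (hD : ∀ v x, D (ExteriorAlgebra.ι R v * x) =
      C v⌋x + ExteriorAlgebra.ι R v * D x)
    (hCD : ∀ v x, C v⌋(D x) = 0) (x : ExteriorAlgebra R W) :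
    pfFunctional (B + C) hBC x = pfFunctional B hB x + pfFunctional B hB (D x) := by
  have hexp : ∀ x, expContract C hC x = x + D x := by
    intro x
    induction x using CliffordAlgebra.left_induction with
    | algebraMap r =>
      have : D (algebraMap R _ r) = 0 := by rw [Algebra.algebraMap_eq_smul_one, map_smul, hD1, smul_zero]
      rw [this, add_zero]
      exact CliffordAlgebra.changeForm_algebraMap _ r
    | add x y hx hy => rw [map_add, map_add, hx, hy]; abel
    | ι_mul x v hx =>
      have h1 := expContract_ι_mul C hC v x
      have h2 := hD v x
      rw [hx, map_add, hCD, add_zero] at h1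
      refine h1.trans ?_
      erw [h2]
      rw [mul_add]; abel
  have := CliffordAlgebra.changeForm_changeForm (neg_toQuadraticMap_of_alt C hC)
    (neg_toQuadraticMap_of_alt B hB) x
  have h3 : expContract (B + C) hBC x = expContract B hB (expContract C hC x) := by
    refine Eq.trans ?_ this.symm
    unfold expContract
    congr 2
    abel
  simp only [pfFunctional, LinearMap.comp_apply, h3, hexp, map_add]

/-- For `C = μ ∧ ν` the series stops because contracting twice with `μ`, or twice with `ν`, gives 0.
-/
lemma pfFunctional_add_wedgeForm (B : W →ₗ[R] W →ₗ[R] R) (μ ν : Module.Dual R W)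
    (hB : ∀ x, B x x = 0) (hBC : ∀ x, (B + wedgeForm μ ν) x x = 0) (x : ExteriorAlgebra R W) :
    pfFunctional (B + wedgeForm μ ν) hBC x =
      pfFunctional B hB x + pfFunctional B hB (ν⌋(μ⌋x)) := by
  refine pfFunctional_add B _ hB (wedgeForm_self μ ν) hBC
    (CliffordAlgebra.contractLeft (Q := 0) ν ∘ₗ CliffordAlgebra.contractLeft (Q := 0) μ) ?_ ?_ ?_ x
  · erw [LinearMap.comp_apply, CliffordAlgebra.contractLeft_one, map_zero]
  · intro v x
    simp only [LinearMap.comp_apply, contractLeft_ι_mul', map_sub, map_smul, wedgeForm,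
      LinearMap.sub_apply, LinearMap.smulRight_apply, LinearMap.smul_apply]
    abel
  · intro v x
    simp only [LinearMap.comp_apply, wedgeForm, LinearMap.sub_apply, LinearMap.smulRight_apply,
      map_sub, map_smul, LinearMap.smul_apply]
    rw [CliffordAlgebra.contractLeft_contractLeft, CliffordAlgebra.contractLeft_comm,
      CliffordAlgebra.contractLeft_contractLeft]
    simp

end pf

/-! ### The Pfaffian of `ψ_{2n}`, degenerate forms, and contractions in rank two -/

section pf

variable {R W : Type u} [CommRing R] [AddCommGroup W] [Module R W]

local infixl:70 "⌋" => CliffordAlgebra.contractLeft (Q := (0 : QuadraticForm R _))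

/-- A product of two vectors is central, since passing any vector across it costs two signs. -/
lemma ι_mul_ι_mul_comm (a b : W) (x : ExteriorAlgebra R W) :
    ExteriorAlgebra.ι R a * ExteriorAlgebra.ι R b * x =
      x * (ExteriorAlgebra.ι R a * ExteriorAlgebra.ι R b) := by
  have hs : ∀ a b : W, ExteriorAlgebra.ι R a * ExteriorAlgebra.ι R b =
      -(ExteriorAlgebra.ι R b * ExteriorAlgebra.ι R a) := fun a b =>
    eq_neg_of_add_eq_zero_left (ExteriorAlgebra.ι_add_mul_swap a b)
  induction x using ExteriorAlgebra.induction with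
  | algebraMap r => exact (Algebra.commutes r _).symm
  | ι c =>
    rw [mul_assoc, hs b c, mul_neg, ← mul_assoc, hs a c, neg_mul, neg_neg, mul_assoc]
  | mul x y hx hy => rw [← mul_assoc, hx, mul_assoc, hy, mul_assoc]
  | add x y hx hy => rw [mul_add, add_mul, hx, hy]

lemma contractLeft_ιMulti_eq_zero (d : Module.Dual R W) (n : ℕ) (v : Fin n → W)
    (h : ∀ i, d (v i) = 0) : d⌋(ExteriorAlgebra.ιMulti R n v) = 0 := by
  cases n with
  | zero => rw [ExteriorAlgebra.ιMulti_zero_apply]; exact CliffordAlgebra.contractLeft_one (Q := 0) d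
  | succ n => rw [contractLeft_ιMulti]; simp [h]

lemma AltIso.ofMatrix_form_single {m : ℕ} (M : Matrix (Fin m) (Fin m) R) (hM : IsAltInvertible M)
    (i j : Fin m) : (AltIso.ofMatrix M hM).form (Pi.single i 1) (Pi.single j 1) = M i j := by
  simp only [AltIso.ofMatrix]
  rw [Matrix.toLinearMap₂'_apply']
  simp

/-- The recursion of `psi` adds its plane at the end while `pfaffian` expands at the beginning. In
the exterior algebra the last two basis vectors can be moved to the front; the first of them then
pairs only with the second. -/
lemma pfaffian_psi (R : Type u) [CommRing R] (n : ℕ) : pfaffian n (psi R n) = 1 := by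
  induction n with
  | zero => rfl
  | succ n ih =>
    let A : Matrix (Fin (2 * n + 2)) (Fin (2 * n + 2)) R := psi R (n + 1)
    let B : (Fin (2 * n + 2) → R) →ₗ[R] (Fin (2 * n + 2) → R) →ₗ[R] R := Matrix.toLinearMap₂' R A
    have hB : ∀ x, B x x = 0 :=
      (AltIso.ofMatrix (psi R (n + 1)) (psi_isAltInvertible R (n + 1))).alt
    let e : Fin (2 * n + 2) → (Fin (2 * n + 2) → R) := fun i => Pi.single i 1
    have hBe : ∀ i j, B (e i) (e j) = A i j := by
      intro i j
      exact AltIso.ofMatrix_form_single _ (psi_isAltInvertible R (n + 1)) i j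
    have h0 := pfaffian_gram B hB (n + 1) e
    have h1 : (Matrix.of fun i j => B (e i) (e j)) = psi R (n + 1) := by
      ext i j; exact hBe i j
    erw [h1] at h0
    rw [h0]
    have h2 : ExteriorAlgebra.ιMulti R (2 * (n + 1)) e =
        ExteriorAlgebra.ιMulti R (2 * n) (fun i => e (Fin.castAdd 2 i)) *
        ExteriorAlgebra.ιMulti R 2 (fun i => e (Fin.natAdd (2 * n) i)) := by
      rw [ExteriorAlgebra.ιMulti_mul_ιMulti]
      change ExteriorAlgebra.ιMulti R (2 * n + 2) e = _
      congr 1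
      exact (Fin.append_castAdd_natAdd (m := 2 * n) (n := 2) (f := e)).symm
    have h3 : ExteriorAlgebra.ιMulti R 2 (fun i => e (Fin.natAdd (2 * n) i)) =
        ExteriorAlgebra.ι R (e (Fin.natAdd (2 * n) 0)) *
          ExteriorAlgebra.ι R (e (Fin.natAdd (2 * n) 1)) := by
      simp [ExteriorAlgebra.ιMulti_apply, vecTail]
    have hl : ∀ i : Fin (2 * n),
        B (e (Fin.natAdd (2 * n) (0 : Fin 2))) (e (Fin.castAdd 2 i)) = 0 := by
      intro i
      rw [hBe, ← finSumFinEquiv_apply_left, ← finSumFinEquiv_apply_right]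
      simp [A, psi]
    have hr : B (e (Fin.natAdd (2 * n) (0 : Fin 2))) (e (Fin.natAdd (2 * n) (1 : Fin 2))) = 1 := by
      rw [hBe, ← finSumFinEquiv_apply_right, ← finSumFinEquiv_apply_right]
      simp [A, psi]
    have hu : ∀ i j : Fin (2 * n), B (e (Fin.castAdd 2 i)) (e (Fin.castAdd 2 j)) =
        psi R n i j := by
      intro i j
      rw [hBe, ← finSumFinEquiv_apply_left, ← finSumFinEquiv_apply_left]
      simp [A, psi]
    rw [h2, h3, ← ι_mul_ι_mul_comm, mul_assoc, pfFunctional_ι_mul, contractLeft_ι_mul', hr,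
      contractLeft_ιMulti_eq_zero _ _ _ hl, mul_zero, sub_zero, one_smul, ← pfaffian_gram, ← ih]
    congr 1
    ext i j
    exact hu i j

/-- Cramer's rule: multiply by the adjugate. -/
lemma smul_det_of_apply_eq_zero {ι : Type*} [Fintype ι] [DecidableEq ι] (b : Module.Basis ι R W)
    (T : W →ₗ[R] W) (u : W) (h : T u = 0) : LinearMap.det T • u = 0 := by
  have h1 : (LinearMap.toMatrix b b T) *ᵥ (b.repr u) = 0 := by
    rw [LinearMap.toMatrix_mulVec_repr, h]; simp
  have h2 := congrArg (fun z => (LinearMap.toMatrix b b T).adjugate *ᵥ z) h1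
  simp only [Matrix.mulVec_mulVec, Matrix.adjugate_mul, Matrix.mulVec_zero, Matrix.smul_mulVec,
    Matrix.one_mulVec, LinearMap.det_toMatrix] at h2
  apply b.repr.injective
  ext i
  simpa using congrFun h2 i

/-- The top-degree value is an alternating map of the basis, so applying `T` multiplies it by `det T
= 0`; but `T` preserves `B`, hence also the value. -/
lemma pfFunctional_eq_zero_of_degenerate {n : ℕ} (b : Module.Basis (Fin (2 * n)) R W)
    (B : W →ₗ[R] W →ₗ[R] R) (hB : ∀ x, B x x = 0) (T : W →ₗ[R] W)
    (hT : ∀ x y, B (T x) (T y) = B x y) (hdet : LinearMap.det T = 0) :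
    pfFunctional B hB (ExteriorAlgebra.ιMulti R (2 * n) b) = 0 := by
  let L : W [⋀^Fin (2 * n)]→ₗ[R] R :=
    (pfFunctional B hB).compAlternatingMap (ExteriorAlgebra.ιMulti R (2 * n))
  have h1 : L (T ∘ b) = L b := by
    refine (pfaffian_gram B hB n (T ∘ b)).symm.trans (Eq.trans ?_ (pfaffian_gram B hB n b))
    simp [hT]
  have h2 : L (T ∘ b) = L b * (LinearMap.det T * b.det b) := by
    conv_lhs => rw [L.eq_smul_basis_det b]
    rw [AlternatingMap.smul_apply, Module.Basis.det_comp, smul_eq_mul]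
  rw [hdet, zero_mul, mul_zero, h1] at h2
  exact h2

/-- The cross terms between different summands also have to vanish for the series to stop, and `h3`
provides this. It will hold because all the functionals come from a module of rank two. -/
lemma pfFunctional_add_sum_wedgeForm {ι : Type*} (t : Finset ι) (μ ν : ι → Module.Dual R W)
    (B C : W →ₗ[R] W →ₗ[R] R) (hB : ∀ x, B x x = 0) (hC : ∀ x, C x x = 0)
    (hBC : ∀ x, (B + C) x x = 0) (hsum : C = ∑ i ∈ t, wedgeForm (μ i) (ν i))
    (h3 : ∀ i ∈ t, ∀ v x, C v⌋(ν i⌋(μ i⌋x)) = 0) (x : ExteriorAlgebra R W) :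
    pfFunctional (B + C) hBC x =
      pfFunctional B hB x + ∑ i ∈ t, pfFunctional B hB (ν i⌋(μ i⌋x)) := by
  rw [pfFunctional_add B C hB hC hBC
    (∑ i ∈ t, CliffordAlgebra.contractLeft (Q := 0) (ν i) ∘ₗ
      CliffordAlgebra.contractLeft (Q := 0) (μ i)) ?_ ?_ ?_ x]
  · simp
  · rw [LinearMap.sum_apply]
    refine Finset.sum_eq_zero fun i _ => ?_
    erw [LinearMap.comp_apply, CliffordAlgebra.contractLeft_one, map_zero]
  · intro v x
    simp only [LinearMap.sum_apply, LinearMap.comp_apply, hsum, map_sum, Finset.mul_sum,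
      ← Finset.sum_add_distrib]
    refine Finset.sum_congr rfl fun i _ => ?_
    simp only [contractLeft_ι_mul', map_sub, map_smul, wedgeForm,
      LinearMap.sub_apply, LinearMap.smulRight_apply, LinearMap.smul_apply]
    abel
  · intro v x
    simp only [LinearMap.sum_apply, map_sum, LinearMap.comp_apply]
    exact Finset.sum_eq_zero fun i hi => h3 i hi v x

/-- Triple contraction with functionals that factor through a module of rank 2 vanishes. -/
lemma contractLeft_three_eq_zero {P : Type u} [AddCommGroup P] [Module R P] [Module.Finite R P]
    [Module.Projective R P] (hP : HasRankTwo R P) (φ : P →ₗ[R] Module.Dual R W) (p q r : P)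
    (x : ExteriorAlgebra R W) : φ p⌋(φ q⌋(φ r⌋x)) = 0 := by
  let m : P →ₗ[R] Module.End R (ExteriorAlgebra R W) :=
    CliffordAlgebra.contractLeft (Q := (0 : QuadraticForm R W)) ∘ₗ φ
  have hm2 : ∀ p x, m p (m p x) = 0 := fun p x => CliffordAlgebra.contractLeft_contractLeft _ x
  have hmc : ∀ p q x, m p (m q x) = - m q (m p x) := fun p q x =>
    CliffordAlgebra.contractLeft_comm _ _ x
  let T : P [⋀^Fin 3]→ₗ[R] (ExteriorAlgebra R W) :=
    AlternatingMap.mk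
      { toFun := fun v => m (v 0) (m (v 1) (m (v 2) x))
        map_update_add' := by
          intro _ v i a b
          obtain rfl : ‹DecidableEq (Fin 3)› = instDecidableEqFin 3 := Subsingleton.elim _ _
          fin_cases i <;> simp [Function.update]
        map_update_smul' := by
          intro _ v i a b
          obtain rfl : ‹DecidableEq (Fin 3)› = instDecidableEqFin 3 := Subsingleton.elim _ _
          fin_cases i <;> simp [Function.update] }
      (by
        intro v i j hij hne
        change m (v 0) (m (v 1) (m (v 2) x)) = 0
        fin_cases i <;> fin_cases j <;> simp at hij hne ⊢ <;>
          first
          | (rw [hij]; simp only [hm2, map_zero])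
          | (rw [hmc (v 0) (v 1), hij, hm2]; simp))
  exact congrArg (fun S => S ![p, q, r]) (alt3_eq_zero hP T)

end pf

/-! ### The Pfaffian of the forms on `P ⊕ R² ⊕ N` -/

section pf

variable {R P N : Type u} [CommRing R] [AddCommGroup P] [Module R P]
  [AddCommGroup N] [Module R N]

local infixl:70 "⌋" => CliffordAlgebra.contractLeft (Q := (0 : QuadraticForm R _))

/-- Pair the Plücker relation with `y`. In this way `χ` is cut into pieces `μ ∧ ν` without a basis
of `P`. -/
lemma wedgeForm_of_plucker [Module.Finite R P] [Module.Projective R P] (hP : HasRankTwo R P)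
    (χ : P →ₗ[R] P →ₗ[R] R) (hχ : ∀ x, χ x x = 0) (u v x y : P) :
    χ u x * χ v y - χ v x * χ u y = χ u v * χ x y := by
  have h := congrArg (fun z => χ z y) (plucker hP χ hχ u v x)
  simp only [map_add, map_smul, LinearMap.add_apply, LinearMap.smul_apply, smul_eq_mul,
    map_zero, LinearMap.zero_apply] at h
  rw [neg_of_alt χ hχ u x] at h
  linear_combination -h

/-- The form `t χ ⊥ 0 ⊥ h` on `P ⊕ R² ⊕ N`. -/
def scaledForm (χ : P →ₗ[R] P →ₗ[R] R) (h : N →ₗ[R] N →ₗ[R] R) (t : R) :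
    ((P × (R × R)) × N) →ₗ[R] ((P × (R × R)) × N) →ₗ[R] R :=
  t • χ.compl₁₂ (LinearMap.fst R P (R × R) ∘ₗ LinearMap.fst R _ N)
    (LinearMap.fst R P (R × R) ∘ₗ LinearMap.fst R _ N) +
  h.compl₁₂ (LinearMap.snd R _ N) (LinearMap.snd R _ N)

@[simp] lemma scaledForm_apply (χ : P →ₗ[R] P →ₗ[R] R) (h : N →ₗ[R] N →ₗ[R] R) (t : R)
    (v w : (P × (R × R)) × N) : scaledForm χ h t v w = t * χ v.1.1 w.1.1 + h v.2 w.2 := by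
  simp [scaledForm]

variable (R P N) in
/-- The first coordinate of `R²` as a functional on `P ⊕ R² ⊕ N`. -/
def planeFst : Module.Dual R ((P × (R × R)) × N) :=
  LinearMap.fst R R R ∘ₗ LinearMap.snd R P (R × R) ∘ₗ LinearMap.fst R _ N

variable (R P N) in
/-- The second coordinate of `R²` as a functional on `P ⊕ R² ⊕ N`. -/
def planeSnd : Module.Dual R ((P × (R × R)) × N) :=
  LinearMap.snd R R R ∘ₗ LinearMap.snd R P (R × R) ∘ₗ LinearMap.fst R _ N

variable (N) in
/-- The map from `P` to the functionals on `P ⊕ R² ⊕ N` given by a bilinear form on `P`. -/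
def dualOfForm (χ : P →ₗ[R] P →ₗ[R] R) : P →ₗ[R] Module.Dual R ((P × (R × R)) × N) :=
  χ.compl₂ (LinearMap.fst R P (R × R) ∘ₗ LinearMap.fst R _ N)

@[simp] lemma planeFst_apply (v : (P × (R × R)) × N) : planeFst R P N v = v.1.2.1 := rfl
@[simp] lemma planeSnd_apply (v : (P × (R × R)) × N) : planeSnd R P N v = v.1.2.2 := rfl
@[simp] lemma dualOfForm_apply (χ : P →ₗ[R] P →ₗ[R] R) (p : P) (v : (P × (R × R)) × N) :
    dualOfForm N χ p v = χ p v.1.1 := rfl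

/-- The form on `P ⊕ R² ⊕ N` that is the orthogonal sum of `h` with the form
`d χ + χ(q, -) ∧ x + χ(α, -) ∧ y + c x ∧ y` on `P ⊕ R²`. -/
def blockForm (χ : P →ₗ[R] P →ₗ[R] R) (h : N →ₗ[R] N →ₗ[R] R) (α q : P) (c d : R) :
    ((P × (R × R)) × N) →ₗ[R] ((P × (R × R)) × N) →ₗ[R] R :=
  scaledForm χ h d + wedgeForm (dualOfForm N χ q) (planeFst R P N) +
    wedgeForm (dualOfForm N χ α) (planeSnd R P N) +
    wedgeForm (c • planeFst R P N) (planeSnd R P N)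

lemma det_eq_zero_of_apply {W : Type u} [AddCommGroup W] [Module R W] {ι : Type*} [Fintype ι]
    [DecidableEq ι] (b : Module.Basis ι R W) (T : W →ₗ[R] W) (u : W) (h : T u = 0)
    (l : Module.Dual R W) (hl : l u = 1) : LinearMap.det T = 0 := by
  have := congrArg l (smul_det_of_apply_eq_zero b T u h)
  simpa [hl] using this

section
variable (χ : P →ₗ[R] P →ₗ[R] R) (hχ : ∀ x, χ x x = 0) (h : N →ₗ[R] N →ₗ[R] R) (hh : ∀ x, h x x = 0)

include hχ hh in
lemma scaledForm_self (t : R) (x : (P × (R × R)) × N) : scaledForm χ h t x x = 0 := by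
  simp [hχ, hh]

include hχ hh in
lemma blockForm_self (α q : P) (c d : R) (x : (P × (R × R)) × N) :
    blockForm χ h α q c d x x = 0 := by
  simp [blockForm, hχ, hh]; ring

variable {n : ℕ} (b : Module.Basis (Fin (2 * n)) R ((P × (R × R)) × N))

include b in
-- The projection that forgets this coordinate preserves `C` and kills a unimodular vector.
lemma pfFunctional_eq_zero_of_planeFst (C : ((P × (R × R)) × N) →ₗ[R] ((P × (R × R)) × N) →ₗ[R] R)
    (hC : ∀ x, C x x = 0)
    (h : ∀ p y z p' y' z' x x', C ((p, x, y), z) ((p', x', y'), z') =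
      C ((p, 0, y), z) ((p', 0, y'), z')) :
    pfFunctional C hC (ExteriorAlgebra.ιMulti R (2 * n) b) = 0 := by
  refine pfFunctional_eq_zero_of_degenerate b C hC
    ((LinearMap.id.prodMap ((0 : R →ₗ[R] R).prodMap LinearMap.id)).prodMap LinearMap.id)
    (fun v w => (h _ _ _ _ _ _ _ _).symm) ?_
  exact det_eq_zero_of_apply b _ ((0, 1, 0), 0) (by simp) (planeFst R P N) rfl

include b in
lemma pfFunctional_eq_zero_of_planeSnd (C : ((P × (R × R)) × N) →ₗ[R] ((P × (R × R)) × N) →ₗ[R] R)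
    (hC : ∀ x, C x x = 0)
    (h : ∀ p x z p' x' z' y y', C ((p, x, y), z) ((p', x', y'), z') =
      C ((p, x, 0), z) ((p', x', 0), z')) :
    pfFunctional C hC (ExteriorAlgebra.ιMulti R (2 * n) b) = 0 := by
  refine pfFunctional_eq_zero_of_degenerate b C hC
    ((LinearMap.id.prodMap ((LinearMap.id : R →ₗ[R] R).prodMap 0)).prodMap LinearMap.id)
    (fun v w => (h _ _ _ _ _ _ _ _).symm) ?_
  exact det_eq_zero_of_apply b _ ((0, 0, 1), 0) (by simp) (planeSnd R P N) rfl

include b in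
-- `P` may have no unimodular vector. The determinant of the projection still annihilates each `χ (p
-- i) (q i)`, and these sum to 1.
lemma pfFunctional_eq_zero_of_fst {ι : Type*} (t : Finset ι) (p q : ι → P)
    (hpq : ∑ i ∈ t, χ (p i) (q i) = 1)
    (C : ((P × (R × R)) × N) →ₗ[R] ((P × (R × R)) × N) →ₗ[R] R)
    (hC : ∀ x, C x x = 0)
    (h : ∀ p y z p' y' z', C ((p, y), z) ((p', y'), z') = C ((0, y), z) ((0, y'), z')) :
    pfFunctional C hC (ExteriorAlgebra.ιMulti R (2 * n) b) = 0 := by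
  let T : ((P × (R × R)) × N) →ₗ[R] ((P × (R × R)) × N) :=
    ((0 : P →ₗ[R] P).prodMap LinearMap.id).prodMap LinearMap.id
  refine pfFunctional_eq_zero_of_degenerate b C hC T (fun v w => (h _ _ _ _ _ _).symm) ?_
  have h1 : ∀ i, LinearMap.det T * χ (p i) (q i) = 0 := by
    intro i
    have := congrArg (dualOfForm N χ (p i))
      (smul_det_of_apply_eq_zero b T ((q i, 0, 0), 0) (by simp [T]))
    simpa using this
  rw [← mul_one (LinearMap.det T), ← hpq, Finset.mul_sum]
  exact Finset.sum_eq_zero fun i _ => h1 i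

include hχ in
/-- The Pfaffian of `t χ ⊥ h`, expressed by contractions of `⋀ (P ⊕ R² ⊕ N)`, is affine in `t`. -/
lemma pfFunctional_scaledForm [Module.Finite R P] [Module.Projective R P]
    (hP : HasRankTwo R P) {ι : Type*} (t : Finset ι) (p q : ι → P)
    (hpq : ∑ i ∈ t, χ (p i) (q i) = 1) (Y : ExteriorAlgebra R ((P × (R × R)) × N)) (s : R) :
    pfFunctional (scaledForm χ h s) (scaledForm_self χ hχ h hh s) Y =
      pfFunctional (scaledForm χ h 0) (scaledForm_self χ hχ h hh 0) Y +
      s * ∑ i ∈ t, pfFunctional (scaledForm χ h 0) (scaledForm_self χ hχ h hh 0)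
        (dualOfForm N χ (q i)⌋(dualOfForm N χ (p i)⌋Y)) := by
  let C : ((P × (R × R)) × N) →ₗ[R] ((P × (R × R)) × N) →ₗ[R] R :=
    s • χ.compl₁₂ (LinearMap.fst R P (R × R) ∘ₗ LinearMap.fst R _ N)
      (LinearMap.fst R P (R × R) ∘ₗ LinearMap.fst R _ N)
  have hCapp : ∀ v, C v = dualOfForm N χ (s • v.1.1) := by
    intro v; ext w <;> simp [C]
  have hsum : scaledForm χ h s = scaledForm χ h 0 + C := by
    simp [scaledForm, C, add_comm]
  have key := pfFunctional_add_sum_wedgeForm t (fun i => dualOfForm N χ (s • p i))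
    (fun i => dualOfForm N χ (q i)) (scaledForm χ h 0) C (scaledForm_self χ hχ h hh 0)
    (fun x => by simp [C, hχ]) (fun x => by rw [← hsum]; exact scaledForm_self χ hχ h hh s x)
    (by
      refine LinearMap.ext fun v => LinearMap.ext fun w => ?_
      simp only [hCapp, LinearMap.sum_apply, wedgeForm_apply, dualOfForm_apply, map_smul,
        LinearMap.smul_apply, smul_eq_mul]
      -- Inserting `1 = ∑ χ(pᵢ, qᵢ)` turns `s χ` into a sum of forms `μ ∧ ν`.
      rw [← one_mul (χ _ _), ← hpq, Finset.sum_mul, Finset.mul_sum]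
      refine Finset.sum_congr rfl fun i _ => ?_
      rw [← wedgeForm_of_plucker hP χ hχ]
      ring)
    (fun i _ v x => by rw [hCapp]; exact contractLeft_three_eq_zero hP _ _ _ _ _) Y
  simp only [hsum]
  rw [key, Finset.mul_sum]
  congr 1
  refine Finset.sum_congr rfl fun i _ => ?_
  simp

include hχ in
-- The summands `μ ∧ ν` are removed one at a time, each removal giving a double contraction. Of the
-- resulting terms, those missing a plane coordinate or contracting twice with one functional
-- vanish. What remains is `c` times the value of `d χ ⊥ h` on `Y`, which gives `c d r`, and a term
-- with contractions by `χ(α, -)` and `χ(β, -)`, which gives `χ(α, β) r`.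
lemma pfFunctional_blockForm_eq [Module.Finite R P] [Module.Projective R P]
    (hP : HasRankTwo R P) {ι : Type*} (t : Finset ι) (p q : ι → P)
    (hpq : ∑ i ∈ t, χ (p i) (q i) = 1) :
    ∃ r : R, ∀ (α β : P) (c d : R),
      pfFunctional (blockForm χ h α β c d) (blockForm_self χ hχ h hh α β c d)
        (ExteriorAlgebra.ιMulti R (2 * n) b) = (c * d + χ α β) * r := by
  set X := ExteriorAlgebra.ιMulti R (2 * n) b with hX
  set lx := planeFst R P N
  set ly := planeSnd R P N
  set Y := ly⌋(lx⌋X) with hY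
  have h0 := scaledForm_self χ hχ h hh
  refine ⟨∑ i ∈ t, pfFunctional (scaledForm χ h 0) (scaledForm_self χ hχ h hh 0)
        (dualOfForm N χ (q i)⌋(dualOfForm N χ (p i)⌋Y)), fun α β c d => ?_⟩
  -- The affine function of `s` has no constant term: at `s = 0`, adding `x ∧ y` to the form gives
  -- one that ignores `P`, whose Pfaffian is 0.
  have hscale : ∀ s, pfFunctional (scaledForm χ h s) (h0 s) Y = s *
      ∑ i ∈ t, pfFunctional (scaledForm χ h 0) (scaledForm_self χ hχ h hh 0)
        (dualOfForm N χ (q i)⌋(dualOfForm N χ (p i)⌋Y)) := by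
    intro s
    rw [pfFunctional_scaledForm χ hχ h hh hP t p q hpq Y s]
    have h1 := pfFunctional_add_wedgeForm (scaledForm χ h 0) lx ly (h0 0)
      (fun x => by simp [hh, mul_comm]) X
    rw [hX, pfFunctional_eq_zero_of_planeFst b (scaledForm χ h 0) _ (by simp),
      pfFunctional_eq_zero_of_fst χ b t p q hpq _ _ (by simp [lx, ly]), zero_add, ← hX] at h1
    rw [← h1, zero_add]
  set A := dualOfForm N χ β with hA
  set B := dualOfForm N χ α with hB
  have hG1 : ∀ x, (scaledForm χ h d + wedgeForm A lx) x x = 0 := fun x => by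
    simp [hh, hχ, mul_comm]
  have hG2 : ∀ x, (scaledForm χ h d + wedgeForm A lx + wedgeForm B ly) x x = 0 := fun x => by
    simp [hh, hχ, mul_comm]
  have hG3 : ∀ x, (scaledForm χ h d + wedgeForm B ly) x x = 0 := fun x => by
    simp [hh, hχ, mul_comm]
  have hG4 : ∀ x, (scaledForm χ h d + wedgeForm B A) x x = 0 := fun x => by
    simp [hh, hχ, mul_comm]
  have e1 := pfFunctional_add_wedgeForm _ (c • lx) ly hG2 (blockForm_self χ hχ h hh α β c d) X
  have e2 := pfFunctional_add_wedgeForm _ B ly hG1 hG2 X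
  have e3 := pfFunctional_add_wedgeForm _ B ly hG1 hG2 Y
  have e4 := pfFunctional_add_wedgeForm _ A lx (h0 d) hG1 Y
  have e5 := pfFunctional_add_wedgeForm _ A lx (h0 d) hG1 (ly⌋(B⌋X))
  have e6 := pfFunctional_add_wedgeForm _ B ly (h0 d) hG3 X
  have e7 := pfFunctional_add_wedgeForm _ B A (h0 d) hG4 Y
  have z1 := pfFunctional_eq_zero_of_planeSnd b _ hG1 (by simp [lx, A])
  have z2 := pfFunctional_eq_zero_of_planeFst b _ hG3 (by simp [ly, B])
  have z3 := pfFunctional_eq_zero_of_planeFst b _ (h0 d) (by simp)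
  have s3 : ly⌋(B⌋Y) = 0 := by
    rw [hY, CliffordAlgebra.contractLeft_comm B ly, map_neg,
      CliffordAlgebra.contractLeft_contractLeft, neg_zero]
  have s4 : lx⌋(A⌋Y) = 0 := by
    rw [hY, CliffordAlgebra.contractLeft_comm ly lx, map_neg, map_neg,
      CliffordAlgebra.contractLeft_comm A lx, map_neg, CliffordAlgebra.contractLeft_contractLeft]
    simp
  have s5 : lx⌋(A⌋(ly⌋(B⌋X))) = A⌋(B⌋Y) := by
    rw [hY, CliffordAlgebra.contractLeft_comm ly B, map_neg, map_neg,
      CliffordAlgebra.contractLeft_comm lx A, neg_neg, CliffordAlgebra.contractLeft_comm lx B,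
      map_neg, CliffordAlgebra.contractLeft_comm lx ly, map_neg, map_neg, neg_neg]
  -- In rank two `χ(α, -) ∧ χ(β, -)` is `χ(α, β) χ`, so the mixed contraction is the increment of a
  -- function linear in the scale.
  have hBA : scaledForm χ h d + wedgeForm B A = scaledForm χ h (d + χ α β) := by
    refine LinearMap.ext fun v => LinearMap.ext fun w => ?_
    simp only [LinearMap.add_apply, scaledForm_apply, wedgeForm_apply, A, B, dualOfForm_apply]
    linear_combination wedgeForm_of_plucker hP χ hχ α β v.1.1 w.1.1
  simp only [hBA, hscale] at e7
  rw [hscale] at e4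
  rw [s3, map_zero, add_zero] at e3
  rw [s4, map_zero, add_zero] at e4
  rw [s5] at e5
  simp only [← hX] at z1 z2 z3
  rw [z2, z3, zero_add] at e6
  rw [map_smul, LinearMap.smul_apply, map_smul, map_smul, smul_eq_mul, ← hY] at e1
  change pfFunctional (blockForm χ h α β c d) _ X = _ at e1
  rw [e1, e2, e3, e4, e5, z1, ← e6]
  linear_combination -e7

end

end pf

/-! ### Relations in `V(R)` and `V_SL(R)` -/

section classes

variable {R : Type u} [CommRing R] {P P' : Type u} [AddCommGroup P] [Module R P]
  [Module.Finite R P] [Module.Projective R P] [AddCommGroup P'] [Module R P'] [Module.Finite R P']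
  [Module.Projective R P']

lemma gen_pullback (h : P ≃ₗ[R] P') (g f : AltIso R P') :
    gen (g.pullback h) (f.pullback h) = gen g f :=
  congrArg FreeAbelianGroup.of (Quotient.sound ⟨h, rfl, rfl⟩)

lemma V.cls_pullback (h : P ≃ₗ[R] P') (g f : AltIso R P') :
    V.cls (g.pullback h) (f.pullback h) = V.cls g f :=
  congrArg _ (gen_pullback h g f)

lemma V.cls_perp (g f : AltIso R P) (g' f' : AltIso R P') :
    V.cls (g.perp g') (f.perp f') = V.cls g f + V.cls g' f' := by
  have : gen (g.perp g') (f.perp f') - (gen g f + gen g' f') ∈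
      AddSubgroup.closure (sumRelations R ∪ chainRelations R) :=
    AddSubgroup.subset_closure (Or.inl ⟨⟨P, g, f⟩, ⟨P', g', f'⟩, rfl⟩)
  exact (QuotientAddGroup.eq_iff_sub_mem).2 this

lemma V.cls_add_cls (f₀ f₁ f₂ : AltIso R P) : V.cls f₀ f₁ + V.cls f₁ f₂ = V.cls f₀ f₂ := by
  have : gen f₀ f₁ + gen f₁ f₂ - gen f₀ f₂ ∈
      AddSubgroup.closure (sumRelations R ∪ chainRelations R) :=
    AddSubgroup.subset_closure (Or.inr ⟨⟨P, f₀, f₁⟩, f₂, rfl⟩)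
  exact (QuotientAddGroup.eq_iff_sub_mem).2 this

lemma V.cls_self (f : AltIso R P) : V.cls f f = 0 := by
  simpa using V.cls_add_cls f f f

lemma VSL.cls_pullback_right (g f : AltIso R P) (φ : P ≃ₗ[R] P) (hφ : φ ∈ SL R P) :
    VSL.cls g (f.pullback φ) = VSL.cls g f := by
  have : gen g f - gen g (f.pullback φ) ∈
      AddSubgroup.closure (sumRelations R ∪ chainRelations R ∪ slRelations R) :=
    AddSubgroup.subset_closure (Or.inr ⟨⟨P, g, f⟩, φ, hφ, rfl⟩)
  exact ((QuotientAddGroup.eq_iff_sub_mem).2 this).symm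

end classes

/-! ### Matrices of forms and isometric embeddings into `ψ_{2k}` -/

section forms

variable {R : Type u} [CommRing R]

lemma AltIso.ofMatrix_form_single_single {m : ℕ} {M : Matrix (Fin m) (Fin m) R}
    (F : AltIso R (Fin m → R)) (hM : ∀ i j, F.form (Pi.single i 1) (Pi.single j 1) = M i j) :
    ∃ h : IsAltInvertible M, F = AltIso.ofMatrix M h := by
  have hM' : IsAltInvertible M := by
    refine ⟨fun i => by rw [← hM, F.alt], fun i j => by
      rw [← hM, ← hM, neg_of_alt F.form F.alt], ?_⟩
    -- The preimages of the coordinate functionals are the rows of a left inverse of `M`.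
    choose x hx using fun j => F.bij.2 (LinearMap.proj j)
    refine Matrix.isUnit_det_of_left_inverse (B := Matrix.of x) ?_
    ext i j
    have h1 : F.form (x i) (Pi.single j 1) = (1 : Matrix _ _ R) i j := by
      rw [hx]; simp [Matrix.one_apply, Pi.single_apply]
    rw [← h1, pi_eq_sum_univ' (x i), map_sum, LinearMap.sum_apply, Matrix.mul_apply]
    refine Finset.sum_congr rfl fun l _ => ?_
    simp [hM]
  refine ⟨hM', ?_⟩
  ext1
  refine LinearMap.pi_ext' fun i => LinearMap.ext_ring (LinearMap.pi_ext' fun j =>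
    LinearMap.ext_ring ?_)
  exact (hM i j).trans (AltIso.ofMatrix_form_single M hM' i j).symm

/-- The isomorphism `R^m ⊕ R² ≅ R^{m+2}`. -/
def appendPlane (R : Type u) [CommRing R] (m : ℕ) :
    ((Fin m → R) × (R × R)) ≃ₗ[R] (Fin (m + 2) → R) :=
  ((LinearEquiv.refl R _).prodCongr (LinearEquiv.finTwoArrow R R).symm).trans
    ((LinearEquiv.sumArrowLequivProdArrow (Fin m) (Fin 2) R R).symm.trans
      (LinearEquiv.funCongrLeft R R finSumFinEquiv.symm))

@[simp] lemma appendPlane_castAdd (m : ℕ) (v : (Fin m → R) × (R × R)) (i : Fin m) :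
    appendPlane R m v (Fin.castAdd 2 i) = v.1 i := by
  simp [appendPlane, LinearEquiv.funCongrLeft_apply, LinearMap.funLeft_apply]

@[simp] lemma appendPlane_natAdd (m : ℕ) (v : (Fin m → R) × (R × R)) (i : Fin 2) :
    appendPlane R m v (Fin.natAdd m i) = ![v.2.1, v.2.2] i := by
  simp [appendPlane, LinearEquiv.funCongrLeft_apply, LinearMap.funLeft_apply]

/-- The alternating isomorphism `ψ_{2n}`. -/
def psiForm (R : Type u) [CommRing R] (n : ℕ) : AltIso R (Fin (2 * n) → R) :=
  AltIso.ofMatrix (psi R n) (psi_isAltInvertible R n)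

lemma AltIso.ofMatrix_form_apply {m : ℕ} (M : Matrix (Fin m) (Fin m) R) (hM : IsAltInvertible M)
    (x y : Fin m → R) : (AltIso.ofMatrix M hM).form x y = ∑ i, ∑ j, x i * M i j * y j := by
  simp only [AltIso.ofMatrix]
  rw [Matrix.toLinearMap₂'_apply]
  simp only [smul_eq_mul]
  refine Finset.sum_congr rfl fun i _ => Finset.sum_congr rfl fun j _ => ?_
  ring

lemma sum_appendPlane {m : ℕ} (A : Matrix (Fin (m + 2)) (Fin (m + 2)) R)
    (M : Matrix (Fin m) (Fin m) R)
    (h1 : ∀ i j : Fin m, A (Fin.castAdd 2 i) (Fin.castAdd 2 j) = M i j)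
    (h2 : ∀ (i : Fin m) (j : Fin 2), A (Fin.castAdd 2 i) (Fin.natAdd m j) = 0)
    (h3 : ∀ (i : Fin m) (j : Fin 2), A (Fin.natAdd m j) (Fin.castAdd 2 i) = 0)
    (h4 : ∀ i j : Fin 2, A (Fin.natAdd m i) (Fin.natAdd m j) = !![0, 1; -1, 0] i j)
    (v w : (Fin m → R) × (R × R)) :
    ∑ i, ∑ j, appendPlane R m v i * A i j * appendPlane R m w j =
      ∑ i, ∑ j, v.1 i * M i j * w.1 j + (v.2.1 * w.2.2 - v.2.2 * w.2.1) := by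
  simp only [Fin.sum_univ_add, h1, h2, h3, h4, appendPlane_castAdd, appendPlane_natAdd]
  simp
  ring

lemma psiForm_succ (n : ℕ) (v w : (Fin (2 * n) → R) × (R × R)) :
    (psiForm R (n + 1)).form (appendPlane R (2 * n) v) (appendPlane R (2 * n) w) =
      ((psiForm R n).perp (AltIso.psiTwo R)).form v w := by
  have h1 : ∀ i j : Fin (2 * n), psi R (n + 1) (Fin.castAdd 2 i) (Fin.castAdd 2 j) = psi R n i j := by
    intro i j
    rw [← finSumFinEquiv_apply_left, ← finSumFinEquiv_apply_left]
    simp [psi]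
  have h2 : ∀ (i : Fin (2 * n)) (j : Fin 2),
      psi R (n + 1) (Fin.castAdd 2 i) (Fin.natAdd (2 * n) j) = 0 := by
    intro i j
    rw [← finSumFinEquiv_apply_left, ← finSumFinEquiv_apply_right]
    simp [psi]
  have h3 : ∀ (i : Fin (2 * n)) (j : Fin 2),
      psi R (n + 1) (Fin.natAdd (2 * n) j) (Fin.castAdd 2 i) = 0 := by
    intro i j
    rw [← finSumFinEquiv_apply_left, ← finSumFinEquiv_apply_right]
    simp [psi]
  have h4 : ∀ i j : Fin 2, psi R (n + 1) (Fin.natAdd (2 * n) i) (Fin.natAdd (2 * n) j) =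
      !![0, 1; -1, 0] i j := by
    intro i j
    rw [← finSumFinEquiv_apply_right, ← finSumFinEquiv_apply_right]
    simp [psi]
  rw [AltIso.perp_form]
  unfold psiForm
  rw [AltIso.ofMatrix_form_apply, AltIso.ofMatrix_form_apply]
  exact sum_appendPlane _ _ h1 h2 h3 h4 v w

/-- Each `μ ∧ ν` is the pullback of `ψ₂` along `(μ, ν)`, so every summand contributes one hyperbolic
plane. -/
lemma exists_isometry_of_sum_wedgeForm {P ι : Type u} [AddCommGroup P] [Module R P] (t : Finset ι)
    (μ ν : ι → Module.Dual R P) : ∃ (k : ℕ) (j : P →ₗ[R] (Fin (2 * k) → R)),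
      ∀ x y, (psiForm R k).form (j x) (j y) = ∑ i ∈ t, wedgeForm (μ i) (ν i) x y := by
  classical
  induction t using Finset.induction_on with
  | empty => exact ⟨0, 0, fun x y => by simp⟩
  | insert a t ha ih =>
    obtain ⟨k, j, hj⟩ := ih
    refine ⟨k + 1, (appendPlane R (2 * k)).toLinearMap ∘ₗ j.prod ((μ a).prod (ν a)), fun x y => ?_⟩
    refine (psiForm_succ k _ _).trans ?_
    rw [AltIso.perp_form, Finset.sum_insert ha, ← hj]
    simp [AltIso.psiTwo]
    ring

/-- Non-degeneracy of `g` provides an adjoint `r` of `j`. As `j` is isometric, `r` is a retraction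
of it, and `ker r` is the orthogonal complement of the image. -/
lemma exists_orthogonal_complement {P W : Type u} [AddCommGroup P] [Module R P] [AddCommGroup W]
    [Module R W] [Module.Finite R W] [Module.Projective R W] (g : AltIso R P) (Ψ : AltIso R W)
    (j : P →ₗ[R] W) (hj : ∀ x y, Ψ.form (j x) (j y) = g.form x y) :
    ∃ (N : Submodule R W) (_ : Module.Finite R N) (_ : Module.Projective R N) (h : AltIso R N)
      (e : (P × N) ≃ₗ[R] W), g.perp h = Ψ.pullback e := by
  let G : P ≃ₗ[R] Module.Dual R P := LinearEquiv.ofBijective g.form g.bij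
  let r : W →ₗ[R] P := G.symm.toLinearMap ∘ₗ Ψ.form.compl₂ j
  have hr : ∀ w z, g.form (r w) z = Ψ.form w (j z) := fun w z =>
    LinearMap.congr_fun (G.apply_symm_apply (Ψ.form.compl₂ j w)) z
  have hrj : ∀ z, r (j z) = z := by
    intro z
    apply g.bij.1
    ext y
    rw [hr, hj]
  let N := LinearMap.ker r
  let π : W →ₗ[R] N := (LinearMap.id - j ∘ₗ r).codRestrict N fun w => by simp [N, hrj]
  have hπ : ∀ n : N, π n = n := fun n => by ext; simp [π, show r n = 0 from n.2]
  have hfin : Module.Finite R N := Module.Finite.of_surjective π fun n => ⟨n, hπ n⟩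
  have hproj : Module.Projective R N :=
    Module.Projective.of_split N.subtype π (LinearMap.ext hπ)
  have o1 : ∀ (n : N) z, Ψ.form n (j z) = 0 := fun n z => by
    rw [← hr, show r n = 0 from n.2]; simp
  have o2 : ∀ (n : N) z, Ψ.form (j z) n = 0 := fun n z => by
    rw [neg_of_alt Ψ.form Ψ.alt, o1, neg_zero]
  have hdec : ∀ w, w = π w + j (r w) := fun w => by simp [π]
  let h : AltIso R N :=
    { form := Ψ.form.compl₁₂ N.subtype N.subtype
      alt := fun n => Ψ.alt _
      bij := by
        constructor
        · rw [← LinearMap.ker_eq_bot, LinearMap.ker_eq_bot']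
          intro n hn
          refine Subtype.ext ((map_eq_zero_iff Ψ.form Ψ.bij.1).1 (LinearMap.ext fun w => ?_))
          rw [hdec w, map_add, o1, add_zero]
          exact LinearMap.congr_fun hn (π w)
        · intro l
          obtain ⟨w, hw⟩ := Ψ.bij.2 (l ∘ₗ π)
          refine ⟨π w, LinearMap.ext fun n => ?_⟩
          have h1 := LinearMap.congr_fun hw n
          rw [hdec w, map_add, LinearMap.add_apply, o2, add_zero, LinearMap.comp_apply, hπ] at h1
          exact h1 }
  let e : (P × N) ≃ₗ[R] W := LinearEquiv.ofLinearMap (j.coprod N.subtype) (r.prod π)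
    (LinearMap.ext fun w => by
      change j (r w) + π w = w
      rw [add_comm, ← hdec])
    (LinearMap.ext fun v => by
      have h1 : r (j v.1 + v.2) = v.1 := by rw [map_add, hrj, show r v.2 = 0 from v.2.2, add_zero]
      have h2 : π (j v.1 + v.2) = v.2 := by
        ext
        change (j v.1 + v.2 : W) - j (r (j v.1 + v.2)) = v.2
        rw [h1, add_sub_cancel_left]
      exact Prod.ext h1 h2)
  refine ⟨N, hfin, hproj, h, e, ?_⟩
  refine AltIso.ext (LinearMap.ext fun v => LinearMap.ext fun w => ?_)
  change g.form v.1 w.1 + Ψ.form v.2 w.2 = Ψ.form (j v.1 + v.2) (j w.1 + w.2)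
  simp [hj, o1, o2]

end forms

/-! ### The volume form on `P ⊕ R` and an explicit formula for the form of the symbol -/

section volume

variable {R P : Type u} [CommRing R] [AddCommGroup P] [Module R P] [Module.Finite R P]
  [Module.Projective R P] (hP : HasRankTwo R P) (θ₀ : R ≃ₗ[R] ⋀[R]^2 P)

/-- The volume form on `P ⊕ R` given by a trivialization of `det P`. -/
noncomputable def volForm : (P × R) [⋀^Fin 3]→ₗ[R] R :=
  (θ₀.symm.toLinearMap ∘ₗ (detStab hP).symm.toLinearMap).compAlternatingMap
    (exteriorPower.ιMulti R 3)

lemma volForm_inl (p q : P) :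
    volForm hP θ₀ ![(0, 1), (p, 0), (q, 0)] = (detForm hP θ₀).form p q := by
  have h : detStab hP (wedge R P p q) = exteriorPower.ιMulti R 3 ![(0, 1), (p, 0), (q, 0)] :=
    detMap_ιMulti (LinearMap.inl R P R) (0, 1) ![p, q]
  change θ₀.symm ((detStab hP).symm (exteriorPower.ιMulti R 3 _)) = θ₀.symm (wedge R P p q)
  rw [← h, LinearEquiv.symm_apply_apply]

/-- Split each vector along `(0, 1)`. Terms with that vector twice vanish, and so does the term from
`P` alone, since `P` has rank two. -/
lemma volForm_apply (u v w : P × R) : volForm hP θ₀ ![u, v, w] =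
    u.2 * (detForm hP θ₀).form v.1 w.1 + v.2 * (detForm hP θ₀).form w.1 u.1 +
      w.2 * (detForm hP θ₀).form u.1 v.1 := by
  set T := volForm hP θ₀ with hT
  have hcyc : ∀ x y z, T ![x, y, z] = T ![y, z, x] := by
    intro x y z
    have := T.map_perm ![x, y, z] (finRotate 3)
    rw [sign_finRotate] at this
    have e : (![x, y, z] ∘ ⇑(finRotate 3)) = ![y, z, x] := by
      ext i <;> fin_cases i <;> simp
    rw [e] at this
    simpa using this.symm
  have hadd : ∀ x y z : P × R,
      T ![x, y, z] = x.2 * T ![(0, 1), y, z] + T ![(x.1, 0), y, z] := by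
    intro x y z
    have h1 := T.map_vecCons_add ![y, z] (x.2 • ((0, 1) : P × R)) (x.1, 0)
    have h2 := T.map_vecCons_smul ![y, z] x.2 ((0, 1) : P × R)
    rw [h2] at h1
    rw [← smul_eq_mul, ← h1]
    congr 2
    ext <;> simp
  have htt : ∀ x, T ![(0, 1), (0, 1), x] = 0 := fun x =>
    T.map_eq_zero_of_eq _ (i := 0) (j := 1) rfl (by simp)
  have htt' : ∀ x, T ![(0, 1), x, (0, 1)] = 0 := fun x =>
    T.map_eq_zero_of_eq _ (i := 0) (j := 2) rfl (by simp)
  have h3 : ∀ x y z : P, T ![(x, 0), (y, 0), (z, 0)] = 0 := by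
    intro x y z
    have := congrArg (fun S => S ![x, y, z]) (alt3_eq_zero hP (T.compLinearMap
      (LinearMap.inl R P R)))
    simp only [AlternatingMap.compLinearMap_apply, AlternatingMap.zero_apply] at this
    refine Eq.trans ?_ this
    congr 1
    ext i <;> fin_cases i <;> rfl
  have he : ∀ y z : P × R, T ![(0, 1), y, z] = (detForm hP θ₀).form y.1 z.1 := by
    intro y z
    rw [← volForm_inl, ← hT, hcyc, hadd, htt', mul_zero, zero_add, hcyc, hadd, htt, mul_zero,
      zero_add, hcyc]
  rw [hadd, hcyc (u.1, 0), hadd v, hcyc (v.1, 0), hadd w, h3, he, he, he]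
  ring

lemma chi_form (a : Um R (P × R)) (s : a.Sec) (x y : a.ker) :
    (chi hP θ₀ a s).form x y = volForm hP θ₀ ![s.1 1, x, y] := by
  have h : detKer hP a s (wedge R a.ker x y) =
      exteriorPower.ιMulti R 3 ![s.1 1, (x : P × R), (y : P × R)] :=
    detMap_ιMulti a.ker.subtype (s.1 1) ![x, y]
  change θ₀.symm ((detStab hP).symm (detKer hP a s (wedge R a.ker x y))) = _
  rw [h]; rfl

/-- The retraction changes a vector by a multiple of `s(1)`, which the volume form with `s(1)` in
the first slot does not see. The retraction thus disappears, leaving a formula on the fixed module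
`P ⊕ R²`. -/
lemma vForm_form (a : Um R (P × R)) (s : a.Sec) (v w : P × (R × R)) :
    (vForm hP θ₀ a s).form v w =
      volForm hP θ₀ ![s.1 1, (v.1, v.2.1), (w.1, w.2.1)] +
        (a.1 (v.1, v.2.1) * w.2.2 - v.2.2 * a.1 (w.1, w.2.1)) := by
  have hs : ∀ c, s.1 c = c • s.1 1 := fun c => by rw [← map_smul, smul_eq_mul, mul_one]
  change (chi hP θ₀ a s).form (s.retraction (v.1, v.2.1)) (s.retraction (w.1, w.2.1)) + _ = _
  rw [chi_form]
  congr 1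
  have hr : ∀ x, (s.retraction x : P × R) = x - a.1 x • s.1 1 := fun x => by
    rw [← hs]; rfl
  simp only [volForm_apply, hr, Prod.fst_sub, Prod.snd_sub, Prod.smul_fst, Prod.smul_snd, map_sub,
    map_smul, LinearMap.sub_apply, LinearMap.smul_apply, smul_eq_mul, (detForm hP θ₀).alt]
  rw [neg_of_alt (detForm hP θ₀).form (detForm hP θ₀).alt (s.1 1).1 v.1,
    neg_of_alt (detForm hP θ₀).form (detForm hP θ₀).alt (s.1 1).1 w.1]
  ring

end volume

/-! ### The symbol lies in `Ṽ(R)` -/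

section membership

variable {R P : Type u} [CommRing R] [AddCommGroup P] [Module R P] [Module.Finite R P]
  [Module.Projective R P] (hP : HasRankTwo R P) (θ₀ : R ≃ₗ[R] ⋀[R]^2 P)

lemma exists_sum_detForm_eq_one : ∃ (t : Finset (Fin 2 → P)) (p q : (Fin 2 → P) → P),
    ∑ i ∈ t, (detForm hP θ₀).form (p i) (q i) = 1 :=
  exists_sum_eq_one θ₀

include hP in
lemma exists_isometry_psiForm (g : AltIso R P) {ι : Type u} (t : Finset ι) (p q : ι → P)
    (hpq : ∑ i ∈ t, g.form (p i) (q i) = 1) : ∃ (k : ℕ) (j : P →ₗ[R] (Fin (2 * k) → R)),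
      ∀ x y, (psiForm R k).form (j x) (j y) = g.form x y := by
  obtain ⟨k, j, hj⟩ := exists_isometry_of_sum_wedgeForm t (fun i => g.form (p i))
    (fun i => g.form (q i))
  refine ⟨k, j, fun x y => ?_⟩
  rw [hj, ← one_mul (g.form x y), ← hpq, Finset.sum_mul]
  refine Finset.sum_congr rfl fun i _ => ?_
  rw [← wedgeForm_of_plucker hP g.form g.alt, wedgeForm_apply]

/-- The permutation of summands `(P ⊕ Q) ⊕ N ≅ (P ⊕ N) ⊕ Q`. -/
def prodRightComm (R P Q N : Type u) [CommRing R] [AddCommGroup P] [Module R P] [AddCommGroup Q]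
    [Module R Q] [AddCommGroup N] [Module R N] : ((P × Q) × N) ≃ₗ[R] ((P × N) × Q) where
  toFun v := ((v.1.1, v.2), v.1.2)
  invFun v := ((v.1.1, v.2), v.1.2)
  map_add' _ _ := rfl
  map_smul' _ _ := rfl

omit [Module.Finite R P] [Module.Projective R P] in
lemma blockForm_eq_perp_psiTwo {N : Type u} [AddCommGroup N] [Module R N] (g : AltIso R P)
    (h : AltIso R N) (v w : (P × (R × R)) × N) :
    blockForm g.form h.form 0 0 1 1 v w = ((g.perp (AltIso.psiTwo R)).perp h).form v w := by
  simp [blockForm, AltIso.psiTwo]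
  ring

/-- The dictionary behind the Pfaffian computation: `s(1) = (q, d)`, and `a` is `χ(α, -)` on `P` and
`c` on `(0, 1)`. -/
lemma blockForm_eq_vForm_perp {N : Type u} [AddCommGroup N] [Module R N] (h : AltIso R N)
    (a : Um R (P × R)) (s : a.Sec) (α : P)
    (hα : ∀ p, (detForm hP θ₀).form α p = a.1 (p, 0)) (v w : (P × (R × R)) × N) :
    blockForm (detForm hP θ₀).form h.form α (s.1 1).1 (a.1 (0, 1)) (s.1 1).2 v w =
      ((vForm hP θ₀ a s).perp h).form v w := by
  have ha : ∀ p x, a.1 (p, x) = (detForm hP θ₀).form α p + x * a.1 (0, 1) := by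
    intro p x
    rw [hα, ← smul_eq_mul, ← map_smul, ← map_add]
    simp
  rw [AltIso.perp_form, vForm_form, volForm_apply, ha v.1.1 v.1.2.1,
    ha w.1.1 w.1.2.1,
    neg_of_alt (detForm hP θ₀).form (detForm hP θ₀).alt (s.1 1).1 w.1.1]
  simp only [blockForm, LinearMap.add_apply, scaledForm_apply, wedgeForm_apply, dualOfForm_apply,
    planeFst_apply, planeSnd_apply, LinearMap.smul_apply, smul_eq_mul]
  ring

theorem vaserstein_mem_Vtilde (a : Um R (P × R)) (s : a.Sec) :
    vaserstein hP θ₀ a s ∈ Vtilde R := by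
  obtain ⟨t, p, q, hpq⟩ := exists_sum_detForm_eq_one hP θ₀
  set χ := detForm hP θ₀ with hχ
  obtain ⟨k, j, hj⟩ := exists_isometry_psiForm hP χ t p q hpq
  obtain ⟨N, _, _, h, e, he⟩ := exists_orthogonal_complement χ (psiForm R k) j hj
  let E : ((P × (R × R)) × N) ≃ₗ[R] (Fin (2 * (k + 1)) → R) :=
    (prodRightComm R P (R × R) N).trans ((e.prodCongr (LinearEquiv.refl R (R × R))).trans
      (appendPlane R (2 * k)))
  have hE : (χ.perp (AltIso.psiTwo R)).perp h = (psiForm R (k + 1)).pullback E := by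
    refine AltIso.ext (LinearMap.ext fun v => LinearMap.ext fun w => ?_)
    refine Eq.trans ?_ (psiForm_succ k (e (v.1.1, v.2), v.1.2) (e (w.1.1, w.2), w.1.2)).symm
    have := LinearMap.congr_fun (LinearMap.congr_fun (congrArg AltIso.form he) (v.1.1, v.2))
      (w.1.1, w.2)
    rw [AltIso.perp_form, AltIso.pullback_form] at this
    simp only [AltIso.perp_form] at this ⊢
    rw [← this]
    ring
  let b : Module.Basis (Fin (2 * (k + 1))) R ((P × (R × R)) × N) :=
    (Pi.basisFun R (Fin (2 * (k + 1)))).map E.symm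
  have hb : ∀ i, b i = E.symm (Pi.single i 1) := fun i => by simp [b]
  let F : AltIso R (Fin (2 * (k + 1)) → R) := ((vForm hP θ₀ a s).perp h).pullback E.symm
  let M : Matrix (Fin (2 * (k + 1))) (Fin (2 * (k + 1))) R :=
    Matrix.of fun i j => F.form (Pi.single i 1) (Pi.single j 1)
  obtain ⟨hM, hFM⟩ := AltIso.ofMatrix_form_single_single (M := M) F fun _ _ => rfl
  -- Non-degeneracy of `χ` represents the restriction of `a` to `P` by a vector.
  obtain ⟨α, hα⟩ := χ.bij.2 (a.1 ∘ₗ LinearMap.inl R P R)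
  have hα' : ∀ p, χ.form α p = a.1 (p, 0) := fun p => LinearMap.congr_fun hα p
  obtain ⟨r, hr⟩ := pfFunctional_blockForm_eq χ.form χ.alt h.form h.alt b hP t p q hpq
  have hψ : pfaffian (k + 1) (psi R (k + 1)) = r := by
    -- These parameters give `χ ⊥ ψ₂ ⊥ h`, whose Gram matrix in the basis `b` is `ψ_{2k+2}`; this
    -- identifies `r`.
    have h1 := hr 0 0 1 1
    rw [← pfaffian_gram] at h1
    simp only [map_zero, add_zero, one_mul] at h1
    rw [← h1]
    congr 1
    ext i j
    rw [Matrix.of_apply, blockForm_eq_perp_psiTwo, hE, AltIso.pullback_form, hb, hb,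
      LinearEquiv.apply_symm_apply, LinearEquiv.apply_symm_apply]
    exact (AltIso.ofMatrix_form_single _ _ i j).symm
  rw [pfaffian_psi] at hψ
  -- The scalar in the block formula is `a(s(1))`.
  have has : a.1 (0, 1) * (s.1 1).2 + χ.form α (s.1 1).1 = 1 := by
    rw [hα', mul_comm, ← smul_eq_mul, ← map_smul, ← map_add]
    refine (congrArg a.1 ?_).trans (s.apply 1)
    ext <;> simp
  have hpf : pfaffian (k + 1) M = 1 := by
    have h1 := hr α (s.1 1).1 (a.1 (0, 1)) (s.1 1).2
    rw [← pfaffian_gram, has, ← hψ, one_mul] at h1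
    rw [← h1]
    congr 1
    ext i j
    rw [Matrix.of_apply, blockForm_eq_vForm_perp hP θ₀ h a s α hα', hb, hb]
    rfl
  refine AddSubgroup.subset_closure ⟨k + 1, M, hM, hpf, ?_⟩
  rw [← hFM]
  have h1 : V.cls (AltIso.ofMatrix (psi R (k + 1)) (psi_isAltInvertible R (k + 1))) F =
      V.cls ((χ.perp (AltIso.psiTwo R)).perp h) ((vForm hP θ₀ a s).perp h) := by
    rw [hE, ← V.cls_pullback E]
    congr 1
    exact AltIso.ext (LinearMap.ext fun v => LinearMap.ext fun w => by simp [F])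
  rw [h1, V.cls_perp, V.cls_self, add_zero]
  rfl

end membership

/-! ### Trilinear forms, determinants and base change -/

open scoped TensorProduct

section tripleForm

variable {R M : Type*} [CommRing R] [AddCommGroup M] [Module R M]

/-- The alternating trilinear form `l ∧ B`. -/
def tripleForm (l : Module.Dual R M) (B : M →ₗ[R] M →ₗ[R] R) (hB : ∀ x, B x x = 0)
    (hB' : ∀ x y, B x y = - B y x) : M [⋀^Fin 3]→ₗ[R] R :=
  AlternatingMap.mk
    { toFun := fun v => l (v 0) * B (v 1) (v 2) + l (v 1) * B (v 2) (v 0) + l (v 2) * B (v 0) (v 1)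
      map_update_add' := by
        intro _ v i a b
        obtain rfl : ‹DecidableEq (Fin 3)› = instDecidableEqFin 3 := Subsingleton.elim _ _
        fin_cases i <;> simp [Function.update] <;> ring
      map_update_smul' := by
        intro _ v i a b
        obtain rfl : ‹DecidableEq (Fin 3)› = instDecidableEqFin 3 := Subsingleton.elim _ _
        fin_cases i <;> simp [Function.update] <;> ring }
    (by
      intro v i j hij hne
      change l (v 0) * B (v 1) (v 2) + l (v 1) * B (v 2) (v 0) + l (v 2) * B (v 0) (v 1) = 0
      fin_cases i <;> fin_cases j <;> simp at hij hne ⊢ <;>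
        first
        | (rw [hij, hB, hB' (v 2)]; ring)
        | (rw [hij, hB, hB' (v 1)]; ring))

lemma tripleForm_apply (l : Module.Dual R M) (B : M →ₗ[R] M →ₗ[R] R) (hB : ∀ x, B x x = 0)
    (hB' : ∀ x y, B x y = - B y x) (v : Fin 3 → M) : tripleForm l B hB hB' v =
      l (v 0) * B (v 1) (v 2) + l (v 1) * B (v 2) (v 0) + l (v 2) * B (v 0) (v 1) := rfl

end tripleForm

lemma alternatingMap_comp_eq_det_smul {R M : Type*} [CommRing R] [AddCommGroup M] [Module R M]
    {ι : Type*} [Fintype ι] [DecidableEq ι] (b : Module.Basis ι R M) (T : M [⋀^ι]→ₗ[R] R)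
    (φ : M →ₗ[R] M) (v : ι → M) : T (φ ∘ v) = LinearMap.det φ * T v := by
  rw [T.eq_smul_basis_det b]
  simp only [AlternatingMap.smul_apply, Module.Basis.det_comp, smul_eq_mul]
  ring

lemma baseChange_neg_of_alt {R M : Type*} (A : Type*) [CommRing R] [AddCommGroup M] [Module R M]
    [CommRing A] [Algebra R A] (B : LinearMap.BilinForm R M) (hB : ∀ x y, B x y = - B y x)
    (x y : A ⊗[R] M) : B.baseChange A x y = - B.baseChange A y x := by
  induction x using TensorProduct.induction_on with
  | zero => simp
  | add x x' hx hx' => rw [map_add, map_add, LinearMap.add_apply, hx, hx', neg_add]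
  | tmul a m =>
    induction y using TensorProduct.induction_on with
    | zero => simp
    | add x x' hx hx' => rw [map_add, map_add, LinearMap.add_apply, hx, hx', neg_add]
    | tmul b n =>
      rw [LinearMap.BilinForm.baseChange_tmul, LinearMap.BilinForm.baseChange_tmul, hB m n,
        mul_comm b a, neg_smul]

lemma baseChange_self_of_alt {R M : Type*} (A : Type*) [CommRing R] [AddCommGroup M] [Module R M]
    [CommRing A] [Algebra R A] (B : LinearMap.BilinForm R M) (hB : ∀ x, B x x = 0)
    (hB' : ∀ x y, B x y = - B y x) (x : A ⊗[R] M) : B.baseChange A x x = 0 := by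
  induction x using TensorProduct.induction_on with
  | zero => simp
  | add x x' hx hx' =>
    simp only [map_add, LinearMap.add_apply, hx, hx']
    rw [baseChange_neg_of_alt A B hB' x x']
    simp
  | tmul a m => rw [LinearMap.BilinForm.baseChange_tmul, hB, zero_smul]

/-! ### Elements of `SL` -/

section SL

variable {R P P' : Type u} [CommRing R] [AddCommGroup P] [Module R P] [AddCommGroup P']
  [Module R P']

/-- Base change of a transvection is again a transvection, which has determinant 1. -/
lemma transvection_mem_SL {f : Module.Dual R P} {v : P} (h : f v = 0) :
    LinearEquiv.transvection h ∈ SL R P := by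
  intro p
  have h' : Module.Dual.baseChange (Localization.AtPrime p.asIdeal) f (1 ⊗ₜ[R] v) = 0 := by
    rw [Module.Dual.baseChange_apply_tmul, h, zero_smul]
  rw [LinearEquiv.transvection.coe_toLinearMap, LinearMap.transvection.baseChange]
  exact (congrArg LinearMap.det (LinearEquiv.transvection.coe_toLinearMap h').symm).trans
    ((LinearEquiv.coe_det _).symm.trans
      (congrArg Units.val (LinearEquiv.transvection.det_eq_one h')))

lemma conj_mem_SL {φ : P ≃ₗ[R] P} (hφ : φ ∈ SL R P) (e : P ≃ₗ[R] P') :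
    (e.symm.trans φ).trans e ∈ SL R P' := by
  intro p
  rw [← hφ p, ← LinearMap.det_conj _ (e.baseChange R (Localization.AtPrime p.asIdeal) P P')]
  congr 1
  ext x
  simp

/-- Over the local rings both summands are free, so the determinant of a block diagonal map is the
product of determinants. -/
lemma prodCongr_refl_mem_SL [Module.Finite R P] [Module.Projective R P] [Module.Finite R P']
    [Module.Projective R P'] {φ : P ≃ₗ[R] P} (hφ : φ ∈ SL R P) :
    φ.prodCongr (LinearEquiv.refl R P') ∈ SL R (P × P') := by
  intro p
  let L := Localization.AtPrime p.asIdeal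
  have f1 : Module.Free L (L ⊗[R] P) := Module.free_of_flat_of_isLocalRing
  have f2 : Module.Free L (L ⊗[R] P') := Module.free_of_flat_of_isLocalRing
  have h1 := LinearMap.det_prodMap ((φ : P →ₗ[R] P).baseChange L)
    (LinearMap.id : (L ⊗[R] P') →ₗ[L] (L ⊗[R] P'))
  rw [hφ p, LinearMap.det_id, one_mul] at h1
  rw [← h1, ← LinearMap.det_conj _ (TensorProduct.prodRight R L L P P')]
  have hc : ∀ z, TensorProduct.prodRight R L L P P'
      (((φ.prodCongr (LinearEquiv.refl R P') : (P × P') ≃ₗ[R] (P × P')) :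
        (P × P') →ₗ[R] (P × P')).baseChange L z) =
      ((φ : P →ₗ[R] P).baseChange L).prodMap LinearMap.id
        (TensorProduct.prodRight R L L P P' z) := by
    intro z
    induction z using TensorProduct.induction_on with
    | zero => simp only [map_zero]
    | add x y hx hy => simp only [map_add, hx, hy]
    | tmul a m => simp
  congr 1
  refine LinearMap.ext fun z => ?_
  obtain ⟨z, rfl⟩ := (TensorProduct.prodRight R L L P P').surjective z
  rw [← hc]
  simp [L]

end SL

/-! ### Independence of the section and invariance under `SL` -/

section volume

variable {R P : Type u} [CommRing R] [AddCommGroup P] [Module R P] [Module.Finite R P]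
  [Module.Projective R P] (hP : HasRankTwo R P) (θ₀ : R ≃ₗ[R] ⋀[R]^2 P)

/-- Equality may be checked after localizing at maximal ideals. There `P ⊕ R` is free of rank 3 and
an alternating trilinear form is scaled by the determinant. The explicit formula for the volume form
says which form to use over the localization. -/
lemma volForm_comp_of_mem_SL {φ : (P × R) ≃ₗ[R] (P × R)} (hφ : φ ∈ SL R (P × R))
    (u v w : P × R) :
    volForm hP θ₀ ![φ u, φ v, φ w] = volForm hP θ₀ ![u, v, w] := by
  rw [← sub_eq_zero]
  refine eq_zero_of_localization _ fun m hm => ?_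
  rw [map_sub, sub_eq_zero]
  let p : PrimeSpectrum R := ⟨m, hm.isPrime⟩
  let L := Localization.AtPrime m
  let K := L ⊗[R] (P × R)
  have : Nontrivial R := PrimeSpectrum.nontrivial p
  have f1 : Module.Free L K := Module.free_of_flat_of_isLocalRing
  have hrank : Module.finrank L K = 3 := by
    have h1 := Module.rankAtStalk_eq_finrank_tensorProduct (M := P × R) p
    rw [Module.rankAtStalk_prod, Pi.add_apply, hP p, Module.rankAtStalk_self] at h1
    exact h1.symm
  let b : Module.Basis (Fin 3) L K := Module.finBasisOfFinrankEq _ _ hrank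
  let B : LinearMap.BilinForm R (P × R) :=
    (detForm hP θ₀).form.compl₁₂ (LinearMap.fst R P R) (LinearMap.fst R P R)
  have hB : ∀ x, B x x = 0 := fun x => (detForm hP θ₀).alt _
  have hB' : ∀ x y, B x y = - B y x := fun x y => neg_of_alt B hB y x
  let T : K [⋀^Fin 3]→ₗ[L] L := tripleForm (Module.Dual.baseChange L (LinearMap.snd R P R))
    (B.baseChange L) (baseChange_self_of_alt L B hB hB') (baseChange_neg_of_alt L B hB')
  have hT : ∀ x : Fin 3 → P × R, T (fun i => 1 ⊗ₜ x i) =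
      algebraMap R L (volForm hP θ₀ ![x 0, x 1, x 2]) := by
    intro x
    rw [volForm_apply]
    have hl : ∀ y : P × R, Module.Dual.baseChange L (LinearMap.snd R P R) (1 ⊗ₜ[R] y) =
        algebraMap R L y.2 := fun y =>
      (Module.Dual.baseChange_apply_tmul L (LinearMap.snd R P R) 1 y).trans
        (Algebra.algebraMap_eq_smul_one _).symm
    have hBL : ∀ y z : P × R, B.baseChange L (1 ⊗ₜ[R] y) (1 ⊗ₜ[R] z) =
        algebraMap R L ((detForm hP θ₀).form y.1 z.1) := fun y z => by
      refine (LinearMap.BilinForm.baseChange_tmul B 1 y 1 z).trans ?_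
      rw [mul_one, Algebra.algebraMap_eq_smul_one]
      rfl
    simp only [T, tripleForm_apply, hl, hBL, map_add, map_mul]
  have h1 := alternatingMap_comp_eq_det_smul b T ((φ : (P × R) →ₗ[R] (P × R)).baseChange L)
    (fun i => 1 ⊗ₜ (![u, v, w] i))
  rw [show LinearMap.det ((φ : (P × R) →ₗ[R] (P × R)).baseChange L) = 1 from hφ p, one_mul, hT] at h1
  have h2 := hT (fun i => φ (![u, v, w] i))
  exact h2.symm.trans h1

/-- Expansion of the trivial 4-form `a ∧ vol` on `P ⊕ R`. -/
lemma volForm_four_term (a : (P × R) →ₗ[R] R) (k s v w : P × R) :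
    a k * volForm hP θ₀ ![s, v, w] - a s * volForm hP θ₀ ![k, v, w] +
      a v * volForm hP θ₀ ![k, s, w] - a w * volForm hP θ₀ ![k, s, v] = 0 := by
  have ha : ∀ x : P × R, a x = a (x.1, 0) + x.2 * a (0, 1) := by
    intro x
    rw [← smul_eq_mul, ← map_smul, ← map_add]
    congr 1
    ext <;> simp
  -- This is `a` on `P` applied to the Plücker relation; the four-term identity is a combination of
  -- four instances of it.
  have hpl : ∀ x y z : P, (detForm hP θ₀).form x y * a (z, 0) +
      (detForm hP θ₀).form y z * a (x, 0) + (detForm hP θ₀).form z x * a (y, 0) = 0 := by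
    intro x y z
    have := congrArg (a ∘ₗ LinearMap.inl R P R)
      (plucker hP (detForm hP θ₀).form (detForm hP θ₀).alt x y z)
    simpa only [map_add, map_smul, smul_eq_mul, map_zero, LinearMap.comp_apply,
      LinearMap.inl_apply] using this
  have hn := neg_of_alt (detForm hP θ₀).form (detForm hP θ₀).alt
  simp only [volForm_apply]
  rw [ha k, ha s, ha v, ha w, hn k.1 v.1, hn k.1 w.1, hn s.1 w.1]
  have e1 := hpl s.1 v.1 w.1
  have e2 := hpl k.1 v.1 w.1
  have e3 := hpl k.1 s.1 w.1
  have e4 := hpl k.1 s.1 v.1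
  rw [hn s.1 w.1] at e1
  rw [hn k.1 w.1] at e2 e3
  rw [hn k.1 v.1] at e4
  linear_combination -k.2 * e1 + s.2 * e2 - v.2 * e3 + w.2 * e4

/-- With `k = s'(1) - s(1)` we have `a(k) = 0` and `a(s(1)) = 1`, so the four-term identity shows
that the two forms differ by `a ∧ vol(k, s(1), -)`. Since `y` enters the form only through `a ∧ y`,
adding `vol(k, s(1), -)` to `y` carries one form into the other. -/
lemma VSL.cls_vForm_section (a : Um R (P × R)) (s s' : a.Sec) (g : AltIso R (P × (R × R))) :
    VSL.cls g (vForm hP θ₀ a s') = VSL.cls g (vForm hP θ₀ a s) := by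
  let π : (P × (R × R)) →ₗ[R] P × R :=
    LinearMap.id.prodMap (LinearMap.fst R R R)
  let f : Module.Dual R (P × (R × R)) :=
    (volForm hP θ₀).toMultilinearMap.toLinearMap ![s'.1 1 - s.1 1, s.1 1, 0] 2 ∘ₗ π
  have hf : ∀ v, f v = volForm hP θ₀ ![s'.1 1 - s.1 1, s.1 1, (v.1, v.2.1)] := by
    intro v
    change volForm hP θ₀ _ = _
    congr 1
    ext i <;> fin_cases i <;> rfl
  have hfv : f (0, (0, 1)) = 0 := by
    rw [hf, volForm_apply]; simp
  have : vForm hP θ₀ a s' = (vForm hP θ₀ a s).pullback (LinearEquiv.transvection hfv) := by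
    refine AltIso.ext (LinearMap.ext fun v => LinearMap.ext fun w => ?_)
    have h4 := volForm_four_term hP θ₀ a.1 (s'.1 1 - s.1 1) (s.1 1) (v.1, v.2.1) (w.1, w.2.1)
    rw [map_sub, s.apply, s'.apply, sub_self, zero_mul, one_mul] at h4
    have hadd : volForm hP θ₀ ![s'.1 1 - s.1 1, (v.1, v.2.1), (w.1, w.2.1)] =
        volForm hP θ₀ ![s'.1 1, (v.1, v.2.1), (w.1, w.2.1)] -
          volForm hP θ₀ ![s.1 1, (v.1, v.2.1), (w.1, w.2.1)] := by
      simp [volForm_apply]; ring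
    have ht : ∀ v, LinearEquiv.transvection hfv v = (v.1, (v.2.1, v.2.2 + f v)) := by
      intro v
      rw [LinearEquiv.transvection.apply]
      ext <;> simp
    rw [AltIso.pullback_form, vForm_form, vForm_form, ht, ht, hf, hf]
    rw [hadd] at h4
    linear_combination -h4
  rw [this]
  exact VSL.cls_pullback_right _ _ _ (transvection_mem_SL hfv)

/-- Independence of the section allows `φ⁻¹ s` as section of `a φ`. For it the form is exactly the
pullback along `φ ⊕ 1`, by invariance of the volume form. -/
lemma VSL.cls_vForm_act (a : Um R (P × R)) {φ : (P × R) ≃ₗ[R] (P × R)} (hφ : φ ∈ SL R (P × R))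
    (s : a.Sec) (s' : (a.act φ).Sec) (g : AltIso R (P × (R × R))) :
    VSL.cls g (vForm hP θ₀ (a.act φ) s') = VSL.cls g (vForm hP θ₀ a s) := by
  let s'' : (a.act φ).Sec := ⟨φ.symm.toLinearMap ∘ₗ s.1, by
    ext
    simp [Um.act, s.apply]⟩
  rw [VSL.cls_vForm_section hP θ₀ (a.act φ) s'' s']
  let e := LinearEquiv.prodAssoc R P R R
  have hΦ := conj_mem_SL (prodCongr_refl_mem_SL (P' := R) hφ) e
  rw [← VSL.cls_pullback_right g (vForm hP θ₀ a s) _ hΦ]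
  congr 1
  refine AltIso.ext (LinearMap.ext fun v => LinearMap.ext fun w => ?_)
  have hv : ∀ v, ((e.symm.trans (φ.prodCongr (LinearEquiv.refl R R))).trans e) v =
      ((φ (v.1, v.2.1)).1, ((φ (v.1, v.2.1)).2, v.2.2)) := fun _ => rfl
  rw [AltIso.pullback_form, vForm_form, vForm_form, hv, hv,
    ← volForm_comp_of_mem_SL hP θ₀ hφ]
  simp [s'', Um.act]

end volume

end GenVaserstein

theorem theorem3p1 {R : Type u} [CommRing R] {P₀ : Type u} [AddCommGroup P₀] [Module R P₀]
    [Module.Finite R P₀] [Module.Projective R P₀] (hP₀ : HasRankTwo R P₀)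
    (θ₀ : R ≃ₗ[R] ⋀[R]^2 P₀) :
    ∃ hV : ∀ (a : Um R (P₀ × R)) (s : a.Sec), vaserstein hP₀ θ₀ a s ∈ Vtilde R,
      (∀ (a : Um R (P₀ × R)) (φ : (P₀ × R) ≃ₗ[R] (P₀ × R)), φ ∈ SL R (P₀ × R) →
        ∀ (s : a.Sec) (s' : (a.act φ).Sec),
          Vtilde.toSL R ⟨vaserstein hP₀ θ₀ a s, hV a s⟩ =
            Vtilde.toSL R ⟨vaserstein hP₀ θ₀ (a.act φ) s', hV (a.act φ) s'⟩) ∧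
      ∃! Vbar : Um.OrbitSL R (P₀ × R) → VtildeSL R,
        ∀ (a : Um R (P₀ × R)) (s : a.Sec),
          Vbar a.orbit = Vtilde.toSL R ⟨vaserstein hP₀ θ₀ a s, hV a s⟩ := by
  have hV := vaserstein_mem_Vtilde hP₀ θ₀
  have hinv : ∀ (a : Um R (P₀ × R)) (φ : (P₀ × R) ≃ₗ[R] (P₀ × R)), φ ∈ SL R (P₀ × R) →
      ∀ (s : a.Sec) (s' : (a.act φ).Sec),
        Vtilde.toSL R ⟨vaserstein hP₀ θ₀ a s, hV a s⟩ =
          Vtilde.toSL R ⟨vaserstein hP₀ θ₀ (a.act φ) s', hV (a.act φ) s'⟩ :=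
    fun a φ hφ s s' => Subtype.ext (VSL.cls_vForm_act hP₀ θ₀ a hφ s s' _).symm
  have hsec : ∀ a : Um R (P₀ × R), Nonempty a.Sec := fun a => by
    obtain ⟨s, hs⟩ := Module.projective_lifting_property a.1 LinearMap.id a.2
    exact ⟨⟨s, hs⟩⟩
  refine ⟨hV, hinv, Quotient.lift (fun a => Vtilde.toSL R
    ⟨vaserstein hP₀ θ₀ a (Classical.choice (hsec a)), hV _ _⟩) ?_, fun a s => ?_, ?_⟩
  · rintro a _ ⟨φ, hφ, rfl⟩
    exact hinv a φ hφ _ _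
  -- The case `φ = 1` compares the chosen section of `a` with `s`.
  · exact hinv a 1 (one_mem _) _ s
  · intro Vbar' h
    funext x
    induction x using Quotient.inductionOn with
    | h a => exact h a _
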